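/- All vector spaces are over $\mathbb{C}$. Set $D=t\frac{d}{dt}$ and $\mathrm{Vir}=\{fD\mid f\in\mathbb{C}[t,t^{-1}]\}$. \emph{Contact superalgebras.} Let $\mathrm{Grass}(N)$ be the Grassmann algebra on $N$ odd variables, endowed with the Poisson bracket determined by a symmetric matrix $([\xi_i,\xi_j])$, that is $[a,b]=-(-1)^{|a|}\sum_{i,j}[\xi_i,\xi_j]\,\partial_i a\,\partial_j b$. Let $\mathrm{K}(N;D)=\mathrm{Grass}(N)\otimes\mathbb{C}[t,t^{-1}]$ with elements $a(f)=a\otimes f$ and bracket $$[a(f),b(g)]=ab\Bigl(\tfrac{2-k}{2}fD(g)-\tfrac{2-l}{2}gD(f)\Bigr)+[a,b](fg)$$ for $a,b$ homogeneous of degree $k,l$ in the odd variables. Put $\mathrm{K}(3)=\mathrm{K}(3;D)$, where $[\xi_i,\xi_j]=\delta_{i,j}$. For $N=4$ the odd variables are $\zeta_1,\eta_1,\zeta_2,\eta_2$, with $[\zeta_1,\eta_1]=[\zeta_2,\eta_2]=1$ and all other brackets zero, and $\mathrm{K}(4)=[\mathrm{K}(4;D),\mathrm{K}(4;D)]$.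 Let $\widehat{\mathrm{K}(4)}=\mathrm{K}(4)\oplus\mathbb{C}c$ be the central extension of $\mathrm{K}(4)$ defined by the $2$-cocycle $$\psi(a(t^n),b(t^m))=\tfrac{2-k}{2}\,\delta_{n+m,0}\,\mathrm{Tr}(ab),\qquad a\in\mathrm{Grass}_k(4),$$ where $\mathrm{Tr}(x)$ is the coefficient of $\zeta_1\eta_1\zeta_2\eta_2$ in $x$. In $\mathrm{K}(3)$ and $\widehat{\mathrm{K}(4)}$ the element $fD$ of $\mathrm{Vir}$ is $1(f)$. \emph{The superalgebra $\mathrm{CK}(6)$.} Let $V=\mathbb{C}^4$ be even with basis $x_1,\dots,x_4$, and let $V^*$ be odd. For a skew-symmetric $4\times4$ matrix $s$ let $\phi(s)$ be the skew-symmetric matrix, linear in $s$, with $\phi(s)s=s\phi(s)=\mathrm{Pf}(s)\,\mathrm{Id}$. Then $\mathrm{CK}(6)$ is the Lie superalgebra (for the supercommutator) of all $8\times 8$ matrices of differential operators, acting on $(V\oplus V^*)\otimes\mathbb{C}[t,t^{-1}]$, $$\begin{pmatrix} a+\bigl(fD+\frac{D(f)}{4}\bigr)\mathrm{Id} & B\\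 H+\phi(B)D+\frac{D(\phi(B))}{2} & -a^T+\bigl(fD+\frac{3D(f)}{4}\bigr)\mathrm{Id}\end{pmatrix},$$ where $f\in\mathbb{C}[t,t^{-1}]$ and $a,B,H$ are $4\times 4$ matrices over $\mathbb{C}[t,t^{-1}]$ which are respectively of trace zero, skew-symmetric and symmetric. Its subalgebra $\mathrm{Vir}$ is given by $a=B=H=0$. Set $h_1=x_1\frac{\partial}{\partial x_1}-x_2\frac{\partial}{\partial x_2}$, $h_2=x_3\frac{\partial}{\partial x_3}-x_4\frac{\partial}{\partial x_4}$, $h_3=x_2\frac{\partial}{\partial x_2}-x_3\frac{\partial}{\partial x_3}$ in $\mathfrak{sl}(V)\subset\mathrm{CK}(6)$ and $c=h_1+h_2+2h_3$; let $C_{\mathrm{CK}(6)}(c)$ be the centralizer of $c$ in $\mathrm{CK}(6)$. \emph{Neveu--Schwarz forms.} The forms $\mathrm{K}(3)_{NS}$, $\widehat{\mathrm{K}(4)}_{NS}$, $\mathrm{CK}(6)_{NS}$ are defined by the same formulas, the coefficients of the odd elements being taken in $t^{1/2}\mathbb{C}[t,t^{-1}]$ instead of $\mathbb{C}[t,t^{-1}]$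 (those of the even elements remain in $\mathbb{C}[t,t^{-1}]$). \textbf{Theorem.} There is an isomorphism of Lie superalgebras $$\widehat{\mathrm{K}(4)}\simeq C_{\mathrm{CK}(6)}(c),$$ and there are embeddings (injective homomorphisms of Lie superalgebras) $$\mathrm{K}(3)\subset\widehat{\mathrm{K}(4)}\subset\mathrm{CK}(6)\quad\text{and}\quad \mathrm{K}(3)_{NS}\subset\widehat{\mathrm{K}(4)}_{NS}\subset\mathrm{CK}(6)_{NS}.$$ All these homomorphisms preserve the subalgebras $\mathrm{Vir}$: they can be chosen so that each of them sends $fD$ to $fD$ for every $f\in\mathbb{C}[t,t^{-1}]$. -/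

import Mathlib

noncomputable section

namespace Superconformal

open LaurentPolynomial Matrix

/-! ### Laurent polynomials in `t` with half-integral exponents -/

/-- The algebra `ℂ[t^{1/2}, t^{-1/2}]`; the monomial `T n` stands for `t^{n/2}`. -/
abbrev HalfLaurent : Type := ℂ[T;T⁻¹]

/-- The Ramond derivation `D = t d/dt`, that is `t^{n/2} ↦ (n/2) t^{n/2}`. -/
def D : HalfLaurent →ₗ[ℂ] HalfLaurent where
  toFun f := f.coeff.sum fun n a => C (((n : ℂ) / 2) * a) * T n
  map_add' f g := by
    rw [AddMonoidAlgebra.coeff_add]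
    exact Finsupp.sum_add_index' (by simp) (by intro n a b; rw [mul_add, map_add, add_mul])
  map_smul' r f := by
    rw [AddMonoidAlgebra.coeff_smul, Finsupp.sum_smul_index' (by simp), Finsupp.smul_sum]
    refine Finsupp.sum_congr fun n _ => ?_
    simp only [RingHom.id_apply, smul_eq_C_mul, smul_eq_mul, ← mul_assoc, ← map_mul]
    congr 2
    ring

/-- `ℂ[t, t⁻¹] ⊂ ℂ[t^{1/2}, t^{-1/2}]`. -/
def integralPowers : Submodule ℂ HalfLaurent :=
  Submodule.span ℂ (Set.range fun n : ℤ => (T (2 * n) : HalfLaurent))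

/-- `t^{1/2} ℂ[t, t⁻¹] ⊂ ℂ[t^{1/2}, t^{-1/2}]`. -/
def halfIntegralPowers : Submodule ℂ HalfLaurent :=
  Submodule.span ℂ (Set.range fun n : ℤ => (T (2 * n + 1) : HalfLaurent))

/-- The two forms of a superconformal algebra. -/
inductive Sector : Type
  | ramond
  | neveuSchwarz

/-- The coefficients of odd elements: `ℂ[t, t⁻¹]` for the Ramond form,
`t^{1/2} ℂ[t, t⁻¹]` for the Neveu-Schwarz form. -/
def Sector.oddCoeff : Sector → Submodule ℂ HalfLaurent
  | .ramond => integralPowers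
  | .neveuSchwarz => halfIntegralPowers

/-- The coefficients of elements of parity `k mod 2`. -/
def Sector.coeff (τ : Sector) (k : ℕ) : Submodule ℂ HalfLaurent :=
  if Even k then integralPowers else τ.oddCoeff

/-! ### Superspaces with a bracket, and their homomorphisms -/

/-- The even part, the odd part and the bracket of a superspace. -/
structure SuperBracket (A : Type) [AddCommGroup A] [Module ℂ A] where
  even : Submodule ℂ A
  odd : Submodule ℂ A
  br : A → A → A

/-- `φ : S → S'` is a homomorphism of Lie superalgebras, where `S` and `S'` are subspaces of
superspaces endowed with a bracket: `φ` preserves the parity, `S` is stable by the bracket and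
`φ [x, y] = [φ x, φ y]`. -/
structure IsSuperHom {A B : Type} [AddCommGroup A] [Module ℂ A] [AddCommGroup B] [Module ℂ B]
    (𝔞 : SuperBracket A) (𝔟 : SuperBracket B) {S : Submodule ℂ A} {S' : Submodule ℂ B}
    (φ : S →ₗ[ℂ] S') : Prop where
  map_even : ∀ x : S, (x : A) ∈ 𝔞.even → (φ x : B) ∈ 𝔟.even
  map_odd : ∀ x : S, (x : A) ∈ 𝔞.odd → (φ x : B) ∈ 𝔟.odd
  map_br : ∀ x y : S, ∃ h : 𝔞.br x y ∈ S, (φ ⟨𝔞.br x y, h⟩ : B) = 𝔟.br (φ x) (φ y)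

/-- `φ : S → S'` maps the copy `f ↦ v f` of `Vir = {f D | f ∈ ℂ[t, t⁻¹]}` in `S` to the copy
`f ↦ v' f` of `Vir` in `S'`. -/
def PreservesVir {A B : Type} [AddCommGroup A] [Module ℂ A] [AddCommGroup B] [Module ℂ B]
    (v : HalfLaurent → A) (v' : HalfLaurent → B) {S : Submodule ℂ A} {S' : Submodule ℂ B}
    (φ : S →ₗ[ℂ] S') : Prop :=
  ∀ f ∈ integralPowers, ∃ h : v f ∈ S, (φ ⟨v f, h⟩ : B) = v' f

/-! ### The contact superalgebras -/

/-- The Grassmann algebra on `ξ_0, …, ξ_{N-1}` with coefficients in `ℂ[t^{1/2}, t^{-1/2}]`.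
The function `x` stands for `∑ S, x S • ξ_S`, where `ξ_S` is the product of the `ξ_i`, `i ∈ S`,
in increasing order. -/
abbrev Grass (N : ℕ) : Type := Finset (Fin N) → HalfLaurent

namespace Grass

variable {N : ℕ}

/-- The sign such that `ξ_S ξ_U = koszulSign S U • ξ_{S ∪ U}` for disjoint `S` and `U`. -/
def koszulSign (S U : Finset (Fin N)) : ℤ :=
  (-1) ^ ((S ×ˢ U).filter fun p => p.2 < p.1).card

/-- The product of the Grassmann algebra. -/
def mul (x y : Grass N) : Grass N :=
  fun U => ∑ S ∈ U.powerset, koszulSign S (U \ S) • (x S * y (U \ S))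

/-- The odd derivation `∂/∂ξ_i` (acting from the left). -/
def partialD (i : Fin N) (x : Grass N) : Grass N :=
  fun U => if i ∈ U then 0 else koszulSign {i} U • x (insert i U)

/-- `x ↦ ((2 - k) / 2) x` on the component of degree `k` in the `ξ_i`; in terms of the Euler
derivation `E`, this is `x - E x / 2`. -/
def halfEuler (x : Grass N) : Grass N :=
  fun S => ((2 - (S.card : ℂ)) / 2) • x S

/-- The Ramond derivation acting on the coefficients. -/
def dt (x : Grass N) : Grass N := fun S => D (x S)

/-- The parity automorphism `x ↦ (-1)^{|x|} x`. -/
def parity (x : Grass N) : Grass N := fun S => (-1 : ℤ) ^ S.card • x S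

/-- The contact bracket. Here `x S • ξ_S` stands for the symbol `ξ_S ⊗ x S D^{(2-|S|)/2}`, and
`g i j = [ξ_i, ξ_j]`. For `a` of degree `k`, `b` of degree `l` in the `ξ_i`, it reads
`[a(f), b(h)] = ab ((2-k)/2 f D(h) - (2-l)/2 h D(f)) + [a, b](f h)`, where
`[a, b] = -(-1)^{|a|} ∑ i j, g i j (∂a/∂ξ_i) (∂b/∂ξ_j)` is the Poisson bracket of the Grassmann
algebra. -/
def contactBracket (g : Matrix (Fin N) (Fin N) ℂ) (x y : Grass N) : Grass N :=
  mul (halfEuler x) (dt y) - mul (dt x) (halfEuler y)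
    - ∑ i, ∑ j, g i j • mul (partialD i (parity x)) (partialD j y)

/-- Even elements. -/
def evenPart (N : ℕ) : Submodule ℂ (Grass N) where
  carrier := {x | ∀ S : Finset (Fin N), Odd S.card → x S = 0}
  add_mem' hx hy S hS := by simp [hx S hS, hy S hS]
  zero_mem' _ _ := rfl
  smul_mem' r x hx S hS := by simp [hx S hS]

/-- Odd elements. -/
def oddPart (N : ℕ) : Submodule ℂ (Grass N) where
  carrier := {x | ∀ S : Finset (Fin N), Even S.card → x S = 0}
  add_mem' hx hy S hS := by simp [hx S hS, hy S hS]
  zero_mem' _ _ := rfl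
  smul_mem' r x hx S hS := by simp [hx S hS]

end Grass

/-- The superspace structure and the contact bracket on `Grass N`. -/
def contact {N : ℕ} (g : Matrix (Fin N) (Fin N) ℂ) : SuperBracket (Grass N) where
  even := Grass.evenPart N
  odd := Grass.oddPart N
  br := Grass.contactBracket g

/-- The superspace `K(N; D)` in its Ramond form, or its Neveu-Schwarz form. -/
def KD (N : ℕ) (τ : Sector) : Submodule ℂ (Grass N) where
  carrier := {x | ∀ S : Finset (Fin N), x S ∈ τ.coeff S.card}
  add_mem' hx hy S := add_mem (hx S) (hy S)
  zero_mem' _ := zero_mem _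
  smul_mem' r _ hx S := Submodule.smul_mem _ r (hx S)

/-- The copy of `Vir` in `Grass N`: the element `f D` is the function `f` (times `ξ_∅ = 1`). -/
def contactVir {N : ℕ} (f : HalfLaurent) : Grass N := Pi.single ∅ f

/-- `[ξ_i, ξ_j] = δ_{i,j}` for the odd variables `ξ_0, ξ_1, ξ_2` of `K(3)`. -/
def form3 : Matrix (Fin 3) (Fin 3) ℂ := 1

/-- `K(3) = K(3; D)` and `K_NS(3)`. -/
def K3 (τ : Sector) : Submodule ℂ (Grass 3) := KD 3 τ

/-- The odd variables of `K(4)` are, in this order, `ζ₁, η₁, ζ₂, η₂`, with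
`[ζ₁, η₁] = [ζ₂, η₂] = 1`, all the other brackets being zero. -/
def form4 : Matrix (Fin 4) (Fin 4) ℂ := !![0, 1, 0, 0; 1, 0, 0, 0; 0, 0, 0, 1; 0, 0, 1, 0]

/-- `K(4) = [K(4; D), K(4; D)]`, and its Neveu-Schwarz form. -/
def K4 (τ : Sector) : Submodule ℂ (Grass 4) :=
  Submodule.span ℂ {z | ∃ x ∈ KD 4 τ, ∃ y ∈ KD 4 τ, z = (contact form4).br x y}

/-- The 2-cocycle `ψ(a(t^n), b(t^m)) = ((2-k)/2) δ_{n+m,0} Tr(ab)`, for `a` of degree `k` in the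
odd variables, where `Tr(ab)` is the coefficient of `ω = ζ₁η₁ζ₂η₂` in `ab`. -/
def psi (x y : Grass 4) : ℂ := (Grass.mul (Grass.halfEuler x) y Finset.univ).coeff 0

/-- The bracket `[(x, z), (y, w)] = ([x, y], ψ(x, y))` of the central extension. The even
central element `c` is `(0, 1)`. -/
def contactHat : SuperBracket (Grass 4 × ℂ) where
  even := (Grass.evenPart 4).prod ⊤
  odd := (Grass.oddPart 4).prod ⊥
  br x y := ((contact form4).br x.1 y.1, psi x.1 y.1)

/-- The central extension `K̂(4) = K(4) ⊕ ℂ c` of `K(4)` defined by the cocycle `ψ`, and its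
Neveu-Schwarz form. -/
def KHat4 (τ : Sector) : Submodule ℂ (Grass 4 × ℂ) := (K4 τ).prod ⊤

/-- The copy of `Vir` in `K̂(4)`. -/
def contactHatVir (f : HalfLaurent) : Grass 4 × ℂ := (contactVir f, 0)

/-! ### The superconformal algebra `CK(6)` -/

/-- Linear operators on `ℂ[t^{1/2}, t^{-1/2}]`; differential operators are among them. -/
abbrev Op : Type := Module.End ℂ HalfLaurent

/-- The operator of multiplication by `f`. -/
def mulOp : HalfLaurent →ₗ[ℂ] Op := LinearMap.mul ℂ HalfLaurent

/-- The `8 × 8` matrices of operators: `End(V ⊕ V*) ⊗ Op`, where `V = ℂ⁴` is even and its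
dual `V*` is odd. -/
abbrev Mat8 : Type := Matrix (Fin 4 ⊕ Fin 4) (Fin 4 ⊕ Fin 4) Op

namespace Mat8

/-- The component of `X` preserving the parity. -/
def evenPart (X : Mat8) : Mat8 := Matrix.fromBlocks X.toBlocks₁₁ 0 0 X.toBlocks₂₂

/-- The component of `X` exchanging the parities. -/
def oddPart (X : Mat8) : Mat8 := Matrix.fromBlocks 0 X.toBlocks₁₂ X.toBlocks₂₁ 0

/-- The supercommutator, equal to `X Y - (-1)^{|X||Y|} Y X` for homogeneous `X` and `Y`. -/
def superCommutator (X Y : Mat8) : Mat8 :=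
  X * Y - Y * evenPart X - (evenPart Y - oddPart Y) * oddPart X

theorem evenPart_add (X Y : Mat8) : evenPart (X + Y) = evenPart X + evenPart Y := by
  rw [evenPart, evenPart, evenPart, Matrix.fromBlocks_add, add_zero]
  rfl

theorem oddPart_add (X Y : Mat8) : oddPart (X + Y) = oddPart X + oddPart Y := by
  rw [oddPart, oddPart, oddPart, Matrix.fromBlocks_add, add_zero]
  rfl

theorem evenPart_smul (r : ℂ) (X : Mat8) : evenPart (r • X) = r • evenPart X := by
  rw [evenPart, evenPart, Matrix.fromBlocks_smul, smul_zero]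
  rfl

theorem oddPart_smul (r : ℂ) (X : Mat8) : oddPart (r • X) = r • oddPart X := by
  rw [oddPart, oddPart, Matrix.fromBlocks_smul, smul_zero]
  rfl

theorem superCommutator_add (X Y Z : Mat8) :
    superCommutator X (Y + Z) = superCommutator X Y + superCommutator X Z := by
  rw [superCommutator, superCommutator, superCommutator, evenPart_add, oddPart_add, mul_add, add_mul,
    add_sub_add_comm (evenPart Y), add_mul]
  abel

theorem superCommutator_smul (r : ℂ) (X Y : Mat8) :
    superCommutator X (r • Y) = r • superCommutator X Y := by
  simp only [superCommutator, evenPart_smul, oddPart_smul, sub_mul, smul_sub, mul_smul_comm,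
    smul_mul_assoc]

/-- Even and odd matrices, and the supercommutator. -/
def superBracket : SuperBracket Mat8 where
  even :=
    { carrier := {X | X.toBlocks₁₂ = 0 ∧ X.toBlocks₂₁ = 0}
      add_mem' := fun {X Y} hX hY =>
        ⟨by rw [show (X + Y).toBlocks₁₂ = X.toBlocks₁₂ + Y.toBlocks₁₂ from rfl, hX.1, hY.1,
            add_zero],
          by rw [show (X + Y).toBlocks₂₁ = X.toBlocks₂₁ + Y.toBlocks₂₁ from rfl, hX.2, hY.2,
            add_zero]⟩
      zero_mem' := ⟨rfl, rfl⟩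
      smul_mem' := fun r X hX =>
        ⟨by rw [show (r • X).toBlocks₁₂ = r • X.toBlocks₁₂ from rfl, hX.1, smul_zero],
          by rw [show (r • X).toBlocks₂₁ = r • X.toBlocks₂₁ from rfl, hX.2, smul_zero]⟩ }
  odd :=
    { carrier := {X | X.toBlocks₁₁ = 0 ∧ X.toBlocks₂₂ = 0}
      add_mem' := fun {X Y} hX hY =>
        ⟨by rw [show (X + Y).toBlocks₁₁ = X.toBlocks₁₁ + Y.toBlocks₁₁ from rfl, hX.1, hY.1,
            add_zero],
          by rw [show (X + Y).toBlocks₂₂ = X.toBlocks₂₂ + Y.toBlocks₂₂ from rfl, hX.2, hY.2,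
            add_zero]⟩
      zero_mem' := ⟨rfl, rfl⟩
      smul_mem' := fun r X hX =>
        ⟨by rw [show (r • X).toBlocks₁₁ = r • X.toBlocks₁₁ from rfl, hX.1, smul_zero],
          by rw [show (r • X).toBlocks₂₂ = r • X.toBlocks₂₂ from rfl, hX.2, smul_zero]⟩ }
  br := superCommutator

end Mat8

/-- The Pfaffian of a skew-symmetric `4 × 4` matrix. -/
def pfaffian {R : Type*} [CommRing R] (s : Matrix (Fin 4) (Fin 4) R) : R :=
  s 0 1 * s 2 3 - s 0 2 * s 1 3 + s 0 3 * s 1 2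

/-- The linear map `φ` on skew-symmetric `4 × 4` matrices. -/
def phi {R : Type*} [CommRing R] (s : Matrix (Fin 4) (Fin 4) R) : Matrix (Fin 4) (Fin 4) R :=
  !![0, -s 2 3, s 1 3, -s 1 2;
     s 2 3, 0, -s 0 3, s 0 2;
     -s 1 3, s 0 3, 0, -s 0 1;
     s 1 2, -s 0 2, s 0 1, 0]

/-- The property that defines `φ`. -/
theorem phi_mul {R : Type*} [CommRing R] (s : Matrix (Fin 4) (Fin 4) R)
    (h0 : ∀ i, s i i = 0) (h : ∀ i j, s j i = -s i j) :
    phi s * s = Matrix.scalar (Fin 4) (pfaffian s) ∧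
      s * phi s = Matrix.scalar (Fin 4) (pfaffian s) := by
  have h10 := h 0 1
  have h20 := h 0 2
  have h30 := h 0 3
  have h21 := h 1 2
  have h31 := h 1 3
  have h32 := h 2 3
  constructor <;> ext i j <;> fin_cases i <;> fin_cases j <;>
    simp [phi, pfaffian, Matrix.mul_apply, Fin.sum_univ_four, h0, h10, h20, h30, h21, h31, h32] <;>
    ring

/-- The `8 × 8` matrix
`⟨a + (f D + D(f)/4) Id, b; h + φ(b) D + D(φ(b))/2, -aᵀ + (f D + 3 D(f)/4) Id⟩`. -/
def ckMatrix (f : HalfLaurent) (a b h : Matrix (Fin 4) (Fin 4) HalfLaurent) : Mat8 :=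
  Matrix.fromBlocks
    (a.map mulOp + Matrix.diagonal fun _ => mulOp f * D + (1 / 4 : ℂ) • mulOp (D f))
    (b.map mulOp)
    (h.map mulOp + (phi b).map fun s => mulOp s * D + (1 / 2 : ℂ) • mulOp (D s))
    (-(aᵀ.map mulOp) + Matrix.diagonal fun _ => mulOp f * D + (3 / 4 : ℂ) • mulOp (D f))

theorem phi_add {R : Type*} [CommRing R] (s s' : Matrix (Fin 4) (Fin 4) R) :
    phi (s + s') = phi s + phi s' := by
  ext i j
  fin_cases i <;> fin_cases j <;> simp [phi] <;> ring

theorem phi_smul (r : ℂ) (s : Matrix (Fin 4) (Fin 4) HalfLaurent) :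
    phi (r • s) = r • phi s := by
  ext1 i j
  fin_cases i <;> fin_cases j <;> simp [phi]

theorem ckMatrix_add (f f' : HalfLaurent) (a a' b b' h h' : Matrix (Fin 4) (Fin 4) HalfLaurent) :
    ckMatrix (f + f') (a + a') (b + b') (h + h') = ckMatrix f a b h + ckMatrix f' a' b' h' := by
  simp only [ckMatrix, Matrix.fromBlocks_add, phi_add]
  congr 1 <;> ext1 i j <;>
    simp only [Matrix.add_apply, Matrix.neg_apply, Matrix.map_apply, Matrix.transpose_apply,
      Matrix.diagonal_apply, map_add, add_mul, smul_add] <;>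
    (try split_ifs) <;> abel

theorem ckMatrix_smul (r : ℂ) (f : HalfLaurent) (a b h : Matrix (Fin 4) (Fin 4) HalfLaurent) :
    ckMatrix (r • f) (r • a) (r • b) (r • h) = r • ckMatrix f a b h := by
  simp only [ckMatrix, Matrix.fromBlocks_smul, phi_smul]
  congr 1 <;> ext1 i j <;>
    simp only [Matrix.add_apply, Matrix.neg_apply, Matrix.smul_apply, Matrix.map_apply,
      Matrix.transpose_apply, Matrix.diagonal_apply, map_smul, smul_mul_assoc, smul_add,
      smul_neg, smul_comm r (1 / 2 : ℂ)] <;>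
    (try split_ifs) <;> simp only [smul_zero, smul_add, smul_comm r (1 / 4 : ℂ),
      smul_comm r (3 / 4 : ℂ)]

/-- `CK(6)` and its Neveu-Schwarz form: the matrices `ckMatrix f a b h` where `f` is a function,
`a` has trace zero, `b` is skew-symmetric and `h` is symmetric. -/
def CK6 (τ : Sector) : Submodule ℂ Mat8 where
  carrier := {X | ∃ f ∈ integralPowers, ∃ a b h : Matrix (Fin 4) (Fin 4) HalfLaurent,
    (∀ i j, a i j ∈ integralPowers) ∧ a.trace = 0 ∧
    (∀ i j, b i j ∈ τ.oddCoeff) ∧ b.transpose = -b ∧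
    (∀ i j, h i j ∈ τ.oddCoeff) ∧ h.transpose = h ∧
    X = ckMatrix f a b h}
  add_mem' := by
    rintro _ _ ⟨f, hf, a, b, h, ha, hat, hb, hbt, hh, hht, rfl⟩
      ⟨f', hf', a', b', h', ha', hat', hb', hbt', hh', hht', rfl⟩
    refine ⟨f + f', add_mem hf hf', a + a', b + b', h + h', fun i j => add_mem (ha i j) (ha' i j),
      ?_, fun i j => add_mem (hb i j) (hb' i j), ?_, fun i j => add_mem (hh i j) (hh' i j), ?_,
      (ckMatrix_add f f' a a' b b' h h').symm⟩
    · rw [Matrix.trace_add, hat, hat', add_zero]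
    · rw [Matrix.transpose_add, hbt, hbt', neg_add]
    · rw [Matrix.transpose_add, hht, hht']
  zero_mem' := by
    refine ⟨0, zero_mem _, 0, 0, 0, fun _ _ => zero_mem _, Matrix.trace_zero _ _,
      fun _ _ => zero_mem _, by simp, fun _ _ => zero_mem _, by simp, ?_⟩
    have := ckMatrix_smul 0 0 0 0 0
    simpa using this.symm
  smul_mem' := by
    rintro r _ ⟨f, hf, a, b, h, ha, hat, hb, hbt, hh, hht, rfl⟩
    refine ⟨r • f, Submodule.smul_mem _ r hf, r • a, r • b, r • h,
      fun i j => Submodule.smul_mem _ r (ha i j), ?_, fun i j => Submodule.smul_mem _ r (hb i j),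
      ?_, fun i j => Submodule.smul_mem _ r (hh i j), ?_, (ckMatrix_smul r f a b h).symm⟩
    · rw [Matrix.trace_smul, hat, smul_zero]
    · rw [Matrix.transpose_smul, hbt, smul_neg]
    · rw [Matrix.transpose_smul, hht]

/-- The copy of `Vir` in `CK(6)`. -/
def ckVir (f : HalfLaurent) : Mat8 := ckMatrix f 0 0 0

/-- The diagonal matrix `x_i ∂/∂x_i - x_j ∂/∂x_j` of `𝔰𝔩(V)`, viewed in `CK(6)`. -/
def ckCoroot (i j : Fin 4) : Mat8 :=
  ckMatrix 0 (Matrix.single i i 1 - Matrix.single j j 1) 0 0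

/-- The simple coroot `h₁`. -/
def h₁ : Mat8 := ckCoroot 0 1

/-- The simple coroot `h₂`. -/
def h₂ : Mat8 := ckCoroot 2 3

/-- The simple coroot `h₃`. -/
def h₃ : Mat8 := ckCoroot 1 2

/-- The element `c = h₁ + h₂ + 2 h₃` of `CK(6)`. -/
def ckC : Mat8 := h₁ + h₂ + (2 : ℂ) • h₃

/-- The centralizer `C_{CK(6)}(c)`. -/
def centralizerC : Submodule ℂ Mat8 where
  carrier := {X | X ∈ CK6 .ramond ∧ Mat8.superBracket.br ckC X = 0}
  add_mem' := fun {X Y} hX hY => ⟨add_mem hX.1 hY.1, by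
    change Mat8.superCommutator _ _ = 0
    rw [Mat8.superCommutator_add, show Mat8.superCommutator ckC X = 0 from hX.2,
      show Mat8.superCommutator ckC Y = 0 from hY.2, add_zero]⟩
  zero_mem' := ⟨zero_mem _, by
    change Mat8.superCommutator _ _ = 0
    simpa using Mat8.superCommutator_smul 0 ckC 0⟩
  smul_mem' := fun r X hX => ⟨Submodule.smul_mem _ r hX.1, by
    change Mat8.superCommutator _ _ = 0
    rw [Mat8.superCommutator_smul, show Mat8.superCommutator ckC X = 0 from hX.2, smul_zero]⟩

end Superconformal

end

open Superconformal

/-!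
The elements of `CK(6)` have weights for `c = diag(1, 1, -1, -1)`, and the centralizer of `c`
consists of the matrices of weight zero: the block `a` preserves the two eigenplanes of `c` in `V`,
and the blocks `b` and `h` pair one plane with the other. So the block `a` is given by two traceless
`2 × 2` matrices, that is an element of `𝔰𝔩(2) ⊕ 𝔰𝔩(2) = 𝔰𝔬(4)`, and by the coefficient of `c`, while
`b` and `h` have four free entries each. The components of degree 2, 1 and 3 of an element `x` of
`K(4)` match the `𝔰𝔬(4)` part of `a`, the block `b` and the block `h`, and its component of degree 0
is the function `f` of `CK(6)`. On the skew-symmetric matrices of weight zero the polarized Pfaffian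
is the bilinear form of `K(4)`.

It remains to relate the coefficient of `ω = ζ₁η₁ζ₂η₂` in `x` and the central coordinate with the
coefficient of `c`. In the contact bracket of `K(4; D)` the coefficient of `ω` is a total derivative
`D(w(x, y))`, where `w(x, y)` is the coefficient of `ω` in `(1 - E/2)(x) y` for the Euler derivation
`E` (`contactBracket_form4_univ`). Hence `K(4)` is the subspace of `K(4; D)` where this coefficient
has no constant term (`mem_K4_iff`), and there it has a primitive, unique up to a constant. The
constant term of `w(x, y)` is precisely `ψ(x, y)`, so `K̂(4)` is `K(4)` together with a choice of this
primitive, the constant term being the central coordinate (`potential`, `potential_br`). Sending the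
primitive to the coefficient of `c` defines `hatToCK`, which is a homomorphism by a comparison of
matrix entries (`superCommutator_toCK`). The formulas are the same in the two sectors, which only
differ by the exponents allowed in the odd components. The map is injective, as the operators
determine the blocks, and the weights of `c` show that in the Ramond sector its image is the
centralizer (`exists_hatToCK_eq`).

The embedding of `K(3)` in `K̂(4)` comes from three orthonormal odd variables among the linear
combinations of `ζ₁, η₁, ζ₂, η₂` (`subst`). It lifts to the central extension with central coordinate
zero, since no product of elements of `Grass(3)` contains `ω`.
-/

noncomputable section

namespace Superconformal

open LaurentPolynomial Matrix

/-! ### Laurent polynomials -/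

theorem D_C_mul_T (n : ℤ) (a : ℂ) : D (C a * T n) = C ((n : ℂ) / 2 * a) * T n := by
  rw [← single_eq_C_mul_T]
  change (Finsupp.sum (Finsupp.single n a) fun n a => C ((n : ℂ) / 2 * a) * T n) = _
  rw [Finsupp.sum_single_index (by simp)]

theorem coeff_D (f : HalfLaurent) (n : ℤ) : (D f).coeff n = (n : ℂ) / 2 * f.coeff n := by
  induction f using LaurentPolynomial.induction_on' with
  | add p q hp hq =>
    rw [map_add, AddMonoidAlgebra.coeff_add, AddMonoidAlgebra.coeff_add, Finsupp.add_apply,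
      Finsupp.add_apply, hp, hq, mul_add]
  | C_mul_T m a =>
    rw [D_C_mul_T, ← single_eq_C_mul_T, ← single_eq_C_mul_T, AddMonoidAlgebra.coeff_single,
      AddMonoidAlgebra.coeff_single, Finsupp.single_apply, Finsupp.single_apply]
    split_ifs with h
    · rw [h]
    · rw [mul_zero]

theorem D_mul (f g : HalfLaurent) : D (f * g) = D f * g + f * D g := by
  induction f using LaurentPolynomial.induction_on' with
  | add p q hp hq => rw [add_mul, map_add, hp, hq, map_add]; ring
  | C_mul_T m a =>
    induction g using LaurentPolynomial.induction_on' with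
    | add p q hp hq => rw [mul_add, map_add, hp, hq, map_add]; ring
    | C_mul_T n b =>
      have h : (C a * T m * (C b * T n) : HalfLaurent) = C (a * b) * T (m + n) := by
        rw [T_add, map_mul]; ring
      have hs : (((m + n : ℤ) : ℂ) / 2 * (a * b)) =
          (m : ℂ) / 2 * a * b + a * ((n : ℂ) / 2 * b) := by
        push_cast; ring
      rw [h, D_C_mul_T, D_C_mul_T, D_C_mul_T, hs, T_add]
      simp only [map_add, map_mul]
      ring

theorem D_C (a : ℂ) : D (C a) = 0 := by
  simpa using D_C_mul_T 0 a

@[simp]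
theorem D_one : D (1 : HalfLaurent) = 0 := by
  simpa using D_C 1

theorem D_T (n : ℤ) : D (T n) = ((n : ℂ) / 2) • T n := by
  simpa [smul_eq_C_mul] using D_C_mul_T n 1

theorem coeff_zero_D (f : HalfLaurent) : (D f).coeff 0 = 0 := by
  simp [coeff_D]

/-- The inverse `t^{n/2} ↦ (2/n) t^{n/2}` of `D` on the Laurent polynomials without constant term.
The constants are sent to `0`, by the convention `2 / 0 = 0`. -/
def antiD : HalfLaurent →ₗ[ℂ] HalfLaurent where
  toFun f := .ofCoeff (Finsupp.onFinset f.coeff.support (fun n => 2 / (n : ℂ) * f.coeff n)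
    fun n hn => Finsupp.mem_support_iff.2 (right_ne_zero_of_mul hn))
  map_add' f g := by
    ext n
    simp [mul_add]
  map_smul' r f := by
    ext n
    simp
    ring

theorem coeff_antiD (f : HalfLaurent) (n : ℤ) : (antiD f).coeff n = 2 / (n : ℂ) * f.coeff n :=
  rfl

theorem antiD_D (f : HalfLaurent) : antiD (D f) + C (f.coeff 0) = f := by
  ext n
  rw [AddMonoidAlgebra.coeff_add, Finsupp.add_apply, coeff_antiD, coeff_D, C_apply]
  split_ifs with h
  · simp [h]
  · have : (n : ℂ) ≠ 0 := by exact_mod_cast h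
    field_simp
    simp

theorem D_antiD (f : HalfLaurent) : D (antiD f) + C (f.coeff 0) = f := by
  ext n
  rw [AddMonoidAlgebra.coeff_add, Finsupp.add_apply, coeff_D, coeff_antiD, C_apply]
  split_ifs with h
  · simp [h]
  · have : (n : ℂ) ≠ 0 := by exact_mod_cast h
    field_simp
    simp

/-- `0` for the Ramond form, `1` for the Neveu-Schwarz form: the powers `t^{n/2}` occurring in the
coefficients of parity `k` are those for which `n + shift * k` is even (`Sector.mem_coeff`). -/
def Sector.shift : Sector → ℤ
  | .ramond => 0
  | .neveuSchwarz => 1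

theorem mem_span_T {e : ℤ} {f : HalfLaurent} :
    f ∈ Submodule.span ℂ (Set.range fun n : ℤ => (T (2 * n + e) : HalfLaurent)) ↔
      ∀ n, f.coeff n ≠ 0 → Even (n + e) := by
  constructor
  · intro hf
    induction hf using Submodule.span_induction with
    | mem x hx =>
      obtain ⟨m, rfl⟩ := hx
      intro n hn
      have h : 2 * m + e = n := by
        by_contra h
        exact hn (by rw [T_apply, if_neg h])
      exact ⟨m + e, by lia⟩
    | zero => simp
    | add x y _ _ hx hy =>
      intro n hn
      by_cases h : x.coeff n = 0
      · refine hy n fun h' => hn ?_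
        rw [AddMonoidAlgebra.coeff_add, Finsupp.add_apply, h, h', add_zero]
      · exact hx n h
    | smul r x _ hx =>
      intro n hn
      refine hx n fun h => hn ?_
      rw [AddMonoidAlgebra.coeff_smul, Finsupp.smul_apply, h, smul_zero]
  · intro h
    rw [show f = f.coeff.sum fun n a => a • T n by
      conv_lhs => rw [← AddMonoidAlgebra.sum_coeff_single f]
      exact Finsupp.sum_congr fun n _ => by rw [single_eq_C_mul_T, smul_eq_C_mul]]
    refine Submodule.sum_mem _ fun n hn => Submodule.smul_mem _ _ (Submodule.subset_span ?_)
    obtain ⟨m, hm⟩ := h n (Finsupp.mem_support_iff.1 hn)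
    exact ⟨m - e, by beta_reduce; congr 1; lia⟩

theorem Sector.mem_coeff {τ : Sector} {k : ℕ} {f : HalfLaurent} :
    f ∈ τ.coeff k ↔ ∀ n, f.coeff n ≠ 0 → Even (n + τ.shift * k) := by
  have h0 : f ∈ integralPowers ↔ ∀ n, f.coeff n ≠ 0 → Even n := by
    simpa [integralPowers] using mem_span_T (e := 0) (f := f)
  have h1 : f ∈ halfIntegralPowers ↔ ∀ n, f.coeff n ≠ 0 → Even (n + 1) := mem_span_T
  rw [Sector.coeff]
  split_ifs with hk
  · rw [h0]
    refine forall_congr' fun n => imp_congr_right fun _ => ?_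
    have : Even (τ.shift * k) := (Int.even_coe_nat k |>.2 hk).mul_left _
    simp [Int.even_add, this]
  · rcases τ with _ | _
    · simp [Sector.oddCoeff, Sector.shift, h0]
    · simp only [Sector.oddCoeff, Sector.shift, h1, one_mul, Int.even_add, Int.even_coe_nat, hk,
        Int.not_even_one]

theorem mem_integralPowers (τ : Sector) {f : HalfLaurent} : f ∈ integralPowers ↔ f ∈ τ.coeff 0 := by
  simp [Sector.coeff]

theorem Sector.coeff_congr (τ : Sector) {k l : ℕ} (h : Even k ↔ Even l) :
    τ.coeff k = τ.coeff l := by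
  simp [Sector.coeff, h]

theorem Sector.mul_mem_coeff {τ : Sector} {k l : ℕ} {f g : HalfLaurent} (hf : f ∈ τ.coeff k)
    (hg : g ∈ τ.coeff l) : f * g ∈ τ.coeff (k + l) := by
  classical
  rw [Sector.mem_coeff] at *
  intro n hn
  have h := AddMonoidAlgebra.support_coeff_mul_subset f g (Finsupp.mem_support_iff.2 hn)
  obtain ⟨a, ha, b, hb, rfl⟩ := Finset.mem_add.1 h
  have := (hf a (Finsupp.mem_support_iff.1 ha)).add (hg b (Finsupp.mem_support_iff.1 hb))
  rwa [show a + b + τ.shift * ((k + l : ℕ) : ℤ) = a + τ.shift * k + (b + τ.shift * l) by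
    push_cast; ring]

theorem Sector.D_mem_coeff {τ : Sector} {k : ℕ} {f : HalfLaurent} (hf : f ∈ τ.coeff k) :
    D f ∈ τ.coeff k := by
  rw [Sector.mem_coeff] at *
  exact fun n hn => hf n (right_ne_zero_of_mul (coeff_D f n ▸ hn))

theorem Sector.antiD_mem_coeff {τ : Sector} {k : ℕ} {f : HalfLaurent} (hf : f ∈ τ.coeff k) :
    antiD f ∈ τ.coeff k := by
  rw [Sector.mem_coeff] at *
  exact fun n hn => hf n (right_ne_zero_of_mul (coeff_antiD f n ▸ hn))

theorem Sector.C_coeff_zero_mem_coeff {τ : Sector} {k : ℕ} {f : HalfLaurent} (hf : f ∈ τ.coeff k) :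
    C (f.coeff 0) ∈ τ.coeff k := by
  rw [Sector.mem_coeff] at *
  intro n hn
  rw [C_apply] at hn
  split_ifs at hn with h
  · exact h ▸ hf 0 hn
  · exact absurd rfl hn

theorem Sector.C_mem_coeff_zero (τ : Sector) (r : ℂ) : C r ∈ τ.coeff 0 := by
  rw [Sector.mem_coeff]
  intro n hn
  rw [C_apply] at hn
  split_ifs at hn with h
  · simp [h]
  · exact absurd rfl hn

theorem T_two_mul_mem (τ : Sector) (n : ℤ) : (T (2 * n) : HalfLaurent) ∈ τ.coeff 0 :=
  (mem_integralPowers τ).1 (Submodule.subset_span ⟨n, rfl⟩)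

/-! ### The Grassmann algebras on three and four variables in coordinates -/

namespace Grass

theorem partialD_of_mem {N : ℕ} {i : Fin N} {U : Finset (Fin N)} (h : i ∈ U) (x : Grass N) :
    partialD i x U = 0 := if_pos h

theorem partialD_eq {N : ℕ} {i : Fin N} {U V : Finset (Fin N)} (h : i ∉ U) (hV : insert i U = V)
    (hs : koszulSign {i} U = 1) (x : Grass N) : partialD i x U = x V := by
  rw [partialD, if_neg h, hV, hs, one_smul]

theorem partialD_eq_neg {N : ℕ} {i : Fin N} {U V : Finset (Fin N)} (h : i ∉ U)
    (hV : insert i U = V) (hs : koszulSign {i} U = -1) (x : Grass N) : partialD i x U = -x V := by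
  rw [partialD, if_neg h, hV, hs, neg_one_smul]

/-- In this table of the products, the right-hand sides have the shape (integer scalars for the
signs, and a final `0`) that makes the equalities definitional. -/
theorem mul3_empty (x y : Grass 3) :
    mul x y ∅ =
      (1 : ℤ) • (x ∅ * y ∅) + 0 :=
  rfl

theorem mul3_0 (x y : Grass 3) :
    mul x y {0} =
      (1 : ℤ) • (x ∅ * y {0}) + ((1 : ℤ) • (x {0} * y ∅) + 0) :=
  rfl

theorem mul3_1 (x y : Grass 3) :
    mul x y {1} =
      (1 : ℤ) • (x ∅ * y {1}) + ((1 : ℤ) • (x {1} * y ∅) + 0) :=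
  rfl

theorem mul3_01 (x y : Grass 3) :
    mul x y {0, 1} =
      (1 : ℤ) • (x ∅ * y {0, 1}) + ((1 : ℤ) • (x {0} * y {1}) + ((-1 : ℤ) • (x {1} * y {0}) +
      ((1 : ℤ) • (x {0, 1} * y ∅) + 0))) :=
  rfl

theorem mul3_2 (x y : Grass 3) :
    mul x y {2} =
      (1 : ℤ) • (x ∅ * y {2}) + ((1 : ℤ) • (x {2} * y ∅) + 0) :=
  rfl

theorem mul3_02 (x y : Grass 3) :
    mul x y {0, 2} =
      (1 : ℤ) • (x ∅ * y {0, 2}) + ((1 : ℤ) • (x {0} * y {2}) + ((-1 : ℤ) • (x {2} * y {0}) +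
      ((1 : ℤ) • (x {0, 2} * y ∅) + 0))) :=
  rfl

theorem mul3_12 (x y : Grass 3) :
    mul x y {1, 2} =
      (1 : ℤ) • (x ∅ * y {1, 2}) + ((1 : ℤ) • (x {1} * y {2}) + ((-1 : ℤ) • (x {2} * y {1}) +
      ((1 : ℤ) • (x {1, 2} * y ∅) + 0))) :=
  rfl

theorem mul3_012 (x y : Grass 3) :
    mul x y {0, 1, 2} =
      (1 : ℤ) • (x ∅ * y {0, 1, 2}) + ((1 : ℤ) • (x {0} * y {1, 2}) +
      ((-1 : ℤ) • (x {1} * y {0, 2}) + ((1 : ℤ) • (x {0, 1} * y {2}) +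
      ((1 : ℤ) • (x {2} * y {0, 1}) + ((-1 : ℤ) • (x {0, 2} * y {1}) +
      ((1 : ℤ) • (x {1, 2} * y {0}) + ((1 : ℤ) • (x {0, 1, 2} * y ∅) + 0))))))) :=
  rfl

theorem mul4_empty (x y : Grass 4) :
    mul x y ∅ =
      (1 : ℤ) • (x ∅ * y ∅) + 0 :=
  rfl

theorem mul4_0 (x y : Grass 4) :
    mul x y {0} =
      (1 : ℤ) • (x ∅ * y {0}) + ((1 : ℤ) • (x {0} * y ∅) + 0) :=
  rfl

theorem mul4_1 (x y : Grass 4) :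
    mul x y {1} =
      (1 : ℤ) • (x ∅ * y {1}) + ((1 : ℤ) • (x {1} * y ∅) + 0) :=
  rfl

theorem mul4_01 (x y : Grass 4) :
    mul x y {0, 1} =
      (1 : ℤ) • (x ∅ * y {0, 1}) + ((1 : ℤ) • (x {0} * y {1}) + ((-1 : ℤ) • (x {1} * y {0}) +
      ((1 : ℤ) • (x {0, 1} * y ∅) + 0))) :=
  rfl

theorem mul4_2 (x y : Grass 4) :
    mul x y {2} =
      (1 : ℤ) • (x ∅ * y {2}) + ((1 : ℤ) • (x {2} * y ∅) + 0) :=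
  rfl

theorem mul4_02 (x y : Grass 4) :
    mul x y {0, 2} =
      (1 : ℤ) • (x ∅ * y {0, 2}) + ((1 : ℤ) • (x {0} * y {2}) + ((-1 : ℤ) • (x {2} * y {0}) +
      ((1 : ℤ) • (x {0, 2} * y ∅) + 0))) :=
  rfl

theorem mul4_12 (x y : Grass 4) :
    mul x y {1, 2} =
      (1 : ℤ) • (x ∅ * y {1, 2}) + ((1 : ℤ) • (x {1} * y {2}) + ((-1 : ℤ) • (x {2} * y {1}) +
      ((1 : ℤ) • (x {1, 2} * y ∅) + 0))) :=
  rfl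

theorem mul4_012 (x y : Grass 4) :
    mul x y {0, 1, 2} =
      (1 : ℤ) • (x ∅ * y {0, 1, 2}) + ((1 : ℤ) • (x {0} * y {1, 2}) +
      ((-1 : ℤ) • (x {1} * y {0, 2}) + ((1 : ℤ) • (x {0, 1} * y {2}) +
      ((1 : ℤ) • (x {2} * y {0, 1}) + ((-1 : ℤ) • (x {0, 2} * y {1}) +
      ((1 : ℤ) • (x {1, 2} * y {0}) + ((1 : ℤ) • (x {0, 1, 2} * y ∅) + 0))))))) :=
  rfl

theorem mul4_3 (x y : Grass 4) :
    mul x y {3} =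
      (1 : ℤ) • (x ∅ * y {3}) + ((1 : ℤ) • (x {3} * y ∅) + 0) :=
  rfl

theorem mul4_03 (x y : Grass 4) :
    mul x y {0, 3} =
      (1 : ℤ) • (x ∅ * y {0, 3}) + ((1 : ℤ) • (x {0} * y {3}) + ((-1 : ℤ) • (x {3} * y {0}) +
      ((1 : ℤ) • (x {0, 3} * y ∅) + 0))) :=
  rfl

theorem mul4_13 (x y : Grass 4) :
    mul x y {1, 3} =
      (1 : ℤ) • (x ∅ * y {1, 3}) + ((1 : ℤ) • (x {1} * y {3}) + ((-1 : ℤ) • (x {3} * y {1}) +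
      ((1 : ℤ) • (x {1, 3} * y ∅) + 0))) :=
  rfl

theorem mul4_013 (x y : Grass 4) :
    mul x y {0, 1, 3} =
      (1 : ℤ) • (x ∅ * y {0, 1, 3}) + ((1 : ℤ) • (x {0} * y {1, 3}) +
      ((-1 : ℤ) • (x {1} * y {0, 3}) + ((1 : ℤ) • (x {0, 1} * y {3}) +
      ((1 : ℤ) • (x {3} * y {0, 1}) + ((-1 : ℤ) • (x {0, 3} * y {1}) +
      ((1 : ℤ) • (x {1, 3} * y {0}) + ((1 : ℤ) • (x {0, 1, 3} * y ∅) + 0))))))) :=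
  rfl

theorem mul4_23 (x y : Grass 4) :
    mul x y {2, 3} =
      (1 : ℤ) • (x ∅ * y {2, 3}) + ((1 : ℤ) • (x {2} * y {3}) + ((-1 : ℤ) • (x {3} * y {2}) +
      ((1 : ℤ) • (x {2, 3} * y ∅) + 0))) :=
  rfl

theorem mul4_023 (x y : Grass 4) :
    mul x y {0, 2, 3} =
      (1 : ℤ) • (x ∅ * y {0, 2, 3}) + ((1 : ℤ) • (x {0} * y {2, 3}) +
      ((-1 : ℤ) • (x {2} * y {0, 3}) + ((1 : ℤ) • (x {0, 2} * y {3}) +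
      ((1 : ℤ) • (x {3} * y {0, 2}) + ((-1 : ℤ) • (x {0, 3} * y {2}) +
      ((1 : ℤ) • (x {2, 3} * y {0}) + ((1 : ℤ) • (x {0, 2, 3} * y ∅) + 0))))))) :=
  rfl

theorem mul4_123 (x y : Grass 4) :
    mul x y {1, 2, 3} =
      (1 : ℤ) • (x ∅ * y {1, 2, 3}) + ((1 : ℤ) • (x {1} * y {2, 3}) +
      ((-1 : ℤ) • (x {2} * y {1, 3}) + ((1 : ℤ) • (x {1, 2} * y {3}) +
      ((1 : ℤ) • (x {3} * y {1, 2}) + ((-1 : ℤ) • (x {1, 3} * y {2}) +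
      ((1 : ℤ) • (x {2, 3} * y {1}) + ((1 : ℤ) • (x {1, 2, 3} * y ∅) + 0))))))) :=
  rfl

theorem mul4_0123 (x y : Grass 4) :
    mul x y {0, 1, 2, 3} =
      (1 : ℤ) • (x ∅ * y {0, 1, 2, 3}) + ((1 : ℤ) • (x {0} * y {1, 2, 3}) +
      ((-1 : ℤ) • (x {1} * y {0, 2, 3}) + ((1 : ℤ) • (x {0, 1} * y {2, 3}) +
      ((1 : ℤ) • (x {2} * y {0, 1, 3}) + ((-1 : ℤ) • (x {0, 2} * y {1, 3}) +
      ((1 : ℤ) • (x {1, 2} * y {0, 3}) + ((1 : ℤ) • (x {0, 1, 2} * y {3}) +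
      ((-1 : ℤ) • (x {3} * y {0, 1, 2}) + ((1 : ℤ) • (x {0, 3} * y {1, 2}) +
      ((-1 : ℤ) • (x {1, 3} * y {0, 2}) + ((-1 : ℤ) • (x {0, 1, 3} * y {2}) +
      ((1 : ℤ) • (x {2, 3} * y {0, 1}) + ((1 : ℤ) • (x {0, 2, 3} * y {1}) +
      ((-1 : ℤ) • (x {1, 2, 3} * y {0}) + ((1 : ℤ) • (x {0, 1, 2, 3} * y ∅) + 0))))))))))))))) :=
  rfl

theorem partialD3_0 (x : Grass 3) :
    partialD 0 x ∅ = x {0} ∧ partialD 0 x {1} = x {0, 1} ∧ partialD 0 x {2} = x {0, 2} ∧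
    partialD 0 x {1, 2} = x {0, 1, 2} := by
  refine ⟨?_, ?_, ?_, ?_⟩ <;>
  exact partialD_eq (by decide) (by decide) (by decide) x

theorem partialD3_1 (x : Grass 3) :
    partialD 1 x ∅ = x {1} ∧ partialD 1 x {0} = -x {0, 1} ∧ partialD 1 x {2} = x {1, 2} ∧
    partialD 1 x {0, 2} = -x {0, 1, 2} := by
  refine ⟨?_, ?_, ?_, ?_⟩ <;>
  first
  | exact partialD_eq (by decide) (by decide) (by decide) x
  | exact partialD_eq_neg (by decide) (by decide) (by decide) x

theorem partialD3_2 (x : Grass 3) :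
    partialD 2 x ∅ = x {2} ∧ partialD 2 x {0} = -x {0, 2} ∧ partialD 2 x {1} = -x {1, 2} ∧
    partialD 2 x {0, 1} = x {0, 1, 2} := by
  refine ⟨?_, ?_, ?_, ?_⟩ <;>
  first
  | exact partialD_eq (by decide) (by decide) (by decide) x
  | exact partialD_eq_neg (by decide) (by decide) (by decide) x

theorem partialD4_0 (x : Grass 4) :
    partialD 0 x ∅ = x {0} ∧ partialD 0 x {1} = x {0, 1} ∧ partialD 0 x {2} = x {0, 2} ∧
    partialD 0 x {1, 2} = x {0, 1, 2} ∧ partialD 0 x {3} = x {0, 3} ∧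
    partialD 0 x {1, 3} = x {0, 1, 3} ∧ partialD 0 x {2, 3} = x {0, 2, 3} ∧
    partialD 0 x {1, 2, 3} = x {0, 1, 2, 3} := by
  refine ⟨?_, ?_, ?_, ?_, ?_, ?_, ?_, ?_⟩ <;>
  exact partialD_eq (by decide) (by decide) (by decide) x

theorem partialD4_1 (x : Grass 4) :
    partialD 1 x ∅ = x {1} ∧ partialD 1 x {0} = -x {0, 1} ∧ partialD 1 x {2} = x {1, 2} ∧
    partialD 1 x {0, 2} = -x {0, 1, 2} ∧ partialD 1 x {3} = x {1, 3} ∧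
    partialD 1 x {0, 3} = -x {0, 1, 3} ∧ partialD 1 x {2, 3} = x {1, 2, 3} ∧
    partialD 1 x {0, 2, 3} = -x {0, 1, 2, 3} := by
  refine ⟨?_, ?_, ?_, ?_, ?_, ?_, ?_, ?_⟩ <;>
  first
  | exact partialD_eq (by decide) (by decide) (by decide) x
  | exact partialD_eq_neg (by decide) (by decide) (by decide) x

theorem partialD4_2 (x : Grass 4) :
    partialD 2 x ∅ = x {2} ∧ partialD 2 x {0} = -x {0, 2} ∧ partialD 2 x {1} = -x {1, 2} ∧
    partialD 2 x {0, 1} = x {0, 1, 2} ∧ partialD 2 x {3} = x {2, 3} ∧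
    partialD 2 x {0, 3} = -x {0, 2, 3} ∧ partialD 2 x {1, 3} = -x {1, 2, 3} ∧
    partialD 2 x {0, 1, 3} = x {0, 1, 2, 3} := by
  refine ⟨?_, ?_, ?_, ?_, ?_, ?_, ?_, ?_⟩ <;>
  first
  | exact partialD_eq (by decide) (by decide) (by decide) x
  | exact partialD_eq_neg (by decide) (by decide) (by decide) x

theorem partialD4_3 (x : Grass 4) :
    partialD 3 x ∅ = x {3} ∧ partialD 3 x {0} = -x {0, 3} ∧ partialD 3 x {1} = -x {1, 3} ∧
    partialD 3 x {0, 1} = x {0, 1, 3} ∧ partialD 3 x {2} = -x {2, 3} ∧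
    partialD 3 x {0, 2} = x {0, 2, 3} ∧ partialD 3 x {1, 2} = x {1, 2, 3} ∧
    partialD 3 x {0, 1, 2} = -x {0, 1, 2, 3} := by
  refine ⟨?_, ?_, ?_, ?_, ?_, ?_, ?_, ?_⟩ <;>
  first
  | exact partialD_eq (by decide) (by decide) (by decide) x
  | exact partialD_eq_neg (by decide) (by decide) (by decide) x

end Grass

/-! ### The contact brackets of `K(3)` and `K(4)` in coordinates -/

namespace Grass

variable {N : ℕ} {S : Finset (Fin N)}

theorem halfEuler_zero (x : Grass N) : halfEuler x ∅ = x ∅ := by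
  simp [halfEuler]

theorem halfEuler_one (x : Grass N) (h : S.card = 1) : halfEuler x S = (1/2 : ℂ) • x S := by
  rw [halfEuler, h]
  norm_num

theorem halfEuler_two (x : Grass N) (h : S.card = 2) : halfEuler x S = 0 := by
  rw [halfEuler, h]
  norm_num

theorem halfEuler_three (x : Grass N) (h : S.card = 3) :
    halfEuler x S = -((1/2 : ℂ) • x S) := by
  rw [halfEuler, h, ← neg_smul]
  norm_num

theorem halfEuler_four (x : Grass N) (h : S.card = 4) : halfEuler x S = -x S := by
  rw [halfEuler, h, ← neg_one_smul ℂ]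
  norm_num

theorem contactBracket_form3 (x y : Grass 3) : contactBracket form3 x y =
    mul (halfEuler x) (dt y) - mul (dt x) (halfEuler y) -
      (mul (partialD 0 (parity x)) (partialD 0 y) + mul (partialD 1 (parity x)) (partialD 1 y) +
        mul (partialD 2 (parity x)) (partialD 2 y)) := by
  simp [contactBracket, form3, Fin.sum_univ_three, Matrix.one_apply]

theorem contactBracket_form4 (x y : Grass 4) : contactBracket form4 x y =
    mul (halfEuler x) (dt y) - mul (dt x) (halfEuler y) -
      (mul (partialD 0 (parity x)) (partialD 1 y) + mul (partialD 1 (parity x)) (partialD 0 y) +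
        mul (partialD 2 (parity x)) (partialD 3 y) + mul (partialD 3 (parity x)) (partialD 2 y)) := by
  simp [contactBracket, form4, Fin.sum_univ_four, add_assoc]

theorem contactBracket_form3_degree_zero (x y : Grass 3) :
    contactBracket form3 x y ∅ = x ∅ * D (y ∅) - D (x ∅) * y ∅ + x {0} * y {0} + x {1} * y {1}
      + x {2} * y {2} := by
  simp [contactBracket_form3, mul3_empty, partialD3_0, partialD3_1, partialD3_2, parity, dt,
      halfEuler_zero]
  ring

theorem contactBracket_form3_degree_one (x y : Grass 3) :
    contactBracket form3 x y {0} = x ∅ * D (y {0}) - (1/2 : ℂ) • (D (x ∅) * y {0})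
      + (1/2 : ℂ) • (x {0} * D (y ∅)) - D (x {0}) * y ∅ - x {1} * y {0, 1} - x {2} * y {0, 2}
      + x {0, 1} * y {1} + x {0, 2} * y {2} ∧
    contactBracket form3 x y {1} = x ∅ * D (y {1}) - (1/2 : ℂ) • (D (x ∅) * y {1})
      + (1/2 : ℂ) • (x {1} * D (y ∅)) - D (x {1}) * y ∅ + x {0} * y {0, 1} - x {2} * y {1, 2}
      - x {0, 1} * y {0} + x {1, 2} * y {2} ∧
    contactBracket form3 x y {2} = x ∅ * D (y {2}) - (1/2 : ℂ) • (D (x ∅) * y {2})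
      + (1/2 : ℂ) • (x {2} * D (y ∅)) - D (x {2}) * y ∅ + x {0} * y {0, 2} + x {1} * y {1, 2}
      - x {0, 2} * y {0} - x {1, 2} * y {1} := by
  refine ⟨?_, ?_, ?_⟩ <;>
  · simp [contactBracket_form3, mul3_0, mul3_1, mul3_2, partialD3_0, partialD3_1, partialD3_2,
        partialD_of_mem, parity, dt, halfEuler_zero, halfEuler_one, smul_eq_C_mul]
    ring

theorem contactBracket_form3_degree_two (x y : Grass 3) :
    contactBracket form3 x y {0, 1} = x ∅ * D (y {0, 1}) + (1/2 : ℂ) • (x {0} * D (y {1}))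
      - (1/2 : ℂ) • (D (x {0}) * y {1}) - (1/2 : ℂ) • (x {1} * D (y {0}))
      + (1/2 : ℂ) • (D (x {1}) * y {0}) - D (x {0, 1}) * y ∅ + x {2} * y {0, 1, 2}
      - x {0, 2} * y {1, 2} + x {1, 2} * y {0, 2} + x {0, 1, 2} * y {2} ∧
    contactBracket form3 x y {0, 2} = x ∅ * D (y {0, 2}) + (1/2 : ℂ) • (x {0} * D (y {2}))
      - (1/2 : ℂ) • (D (x {0}) * y {2}) - (1/2 : ℂ) • (x {2} * D (y {0}))
      + (1/2 : ℂ) • (D (x {2}) * y {0}) - D (x {0, 2}) * y ∅ - x {1} * y {0, 1, 2}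
      + x {0, 1} * y {1, 2} - x {1, 2} * y {0, 1} - x {0, 1, 2} * y {1} ∧
    contactBracket form3 x y {1, 2} = x ∅ * D (y {1, 2}) + (1/2 : ℂ) • (x {1} * D (y {2}))
      - (1/2 : ℂ) • (D (x {1}) * y {2}) - (1/2 : ℂ) • (x {2} * D (y {1}))
      + (1/2 : ℂ) • (D (x {2}) * y {1}) - D (x {1, 2}) * y ∅ + x {0} * y {0, 1, 2}
      - x {0, 1} * y {0, 2} + x {0, 2} * y {0, 1} + x {0, 1, 2} * y {0} := by
  refine ⟨?_, ?_, ?_⟩ <;>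
  · simp [contactBracket_form3, mul3_01, mul3_02, mul3_12, partialD3_0, partialD3_1,
        partialD3_2, partialD_of_mem, parity, dt, halfEuler_zero, halfEuler_one, halfEuler_two,
        smul_eq_C_mul]
    ring

theorem contactBracket_form3_degree_three (x y : Grass 3) :
    contactBracket form3 x y {0, 1, 2} = x ∅ * D (y {0, 1, 2})
      + (1/2 : ℂ) • (D (x ∅) * y {0, 1, 2}) + (1/2 : ℂ) • (x {0} * D (y {1, 2}))
      - (1/2 : ℂ) • (x {1} * D (y {0, 2})) + (1/2 : ℂ) • (x {2} * D (y {0, 1}))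
      - (1/2 : ℂ) • (D (x {0, 1}) * y {2}) + (1/2 : ℂ) • (D (x {0, 2}) * y {1})
      - (1/2 : ℂ) • (D (x {1, 2}) * y {0}) - (1/2 : ℂ) • (x {0, 1, 2} * D (y ∅))
      - D (x {0, 1, 2}) * y ∅ := by
  simp [contactBracket_form3, mul3_012, partialD3_0, partialD3_1, partialD3_2,
      partialD_of_mem, parity, dt, halfEuler_zero, halfEuler_one, halfEuler_two, halfEuler_three,
      smul_eq_C_mul]
  ring

theorem contactBracket_form4_degree_zero (x y : Grass 4) :
    contactBracket form4 x y ∅ = x ∅ * D (y ∅) - D (x ∅) * y ∅ + x {0} * y {1} + x {1} * y {0}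
      + x {2} * y {3} + x {3} * y {2} := by
  simp [contactBracket_form4, mul4_empty, partialD4_0, partialD4_1, partialD4_2, partialD4_3,
      parity, dt, halfEuler_zero]
  ring

theorem contactBracket_form4_degree_one (x y : Grass 4) :
    contactBracket form4 x y {0} = x ∅ * D (y {0}) - (1/2 : ℂ) • (D (x ∅) * y {0})
      + (1/2 : ℂ) • (x {0} * D (y ∅)) - D (x {0}) * y ∅ - x {0} * y {0, 1} - x {2} * y {0, 3}
      - x {3} * y {0, 2} + x {0, 1} * y {0} + x {0, 2} * y {3} + x {0, 3} * y {2} ∧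
    contactBracket form4 x y {1} = x ∅ * D (y {1}) - (1/2 : ℂ) • (D (x ∅) * y {1})
      + (1/2 : ℂ) • (x {1} * D (y ∅)) - D (x {1}) * y ∅ + x {1} * y {0, 1} - x {2} * y {1, 3}
      - x {3} * y {1, 2} - x {0, 1} * y {1} + x {1, 2} * y {3} + x {1, 3} * y {2} ∧
    contactBracket form4 x y {2} = x ∅ * D (y {2}) - (1/2 : ℂ) • (D (x ∅) * y {2})
      + (1/2 : ℂ) • (x {2} * D (y ∅)) - D (x {2}) * y ∅ + x {0} * y {1, 2} + x {1} * y {0, 2}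
      - x {2} * y {2, 3} - x {0, 2} * y {1} - x {1, 2} * y {0} + x {2, 3} * y {2} ∧
    contactBracket form4 x y {3} = x ∅ * D (y {3}) - (1/2 : ℂ) • (D (x ∅) * y {3})
      + (1/2 : ℂ) • (x {3} * D (y ∅)) - D (x {3}) * y ∅ + x {0} * y {1, 3} + x {1} * y {0, 3}
      + x {3} * y {2, 3} - x {0, 3} * y {1} - x {1, 3} * y {0} - x {2, 3} * y {3} := by
  refine ⟨?_, ?_, ?_, ?_⟩ <;>
  · simp [contactBracket_form4, mul4_0, mul4_1, mul4_2, mul4_3, partialD4_0, partialD4_1,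
        partialD4_2, partialD4_3, partialD_of_mem, parity, dt, halfEuler_zero, halfEuler_one,
        smul_eq_C_mul]
    ring

theorem contactBracket_form4_degree_two (x y : Grass 4) :
    contactBracket form4 x y {0, 1} = x ∅ * D (y {0, 1}) + (1/2 : ℂ) • (x {0} * D (y {1}))
      - (1/2 : ℂ) • (D (x {0}) * y {1}) - (1/2 : ℂ) • (x {1} * D (y {0}))
      + (1/2 : ℂ) • (D (x {1}) * y {0}) - D (x {0, 1}) * y ∅ + x {2} * y {0, 1, 3}
      + x {3} * y {0, 1, 2} - x {0, 2} * y {1, 3} - x {0, 3} * y {1, 2} + x {1, 2} * y {0, 3}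
      + x {1, 3} * y {0, 2} + x {0, 1, 2} * y {3} + x {0, 1, 3} * y {2} ∧
    contactBracket form4 x y {0, 2} = x ∅ * D (y {0, 2}) + (1/2 : ℂ) • (x {0} * D (y {2}))
      - (1/2 : ℂ) • (D (x {0}) * y {2}) - (1/2 : ℂ) • (x {2} * D (y {0}))
      + (1/2 : ℂ) • (D (x {2}) * y {0}) - D (x {0, 2}) * y ∅ - x {0} * y {0, 1, 2}
      + x {2} * y {0, 2, 3} + x {0, 1} * y {0, 2} - x {0, 2} * y {2, 3} - x {0, 2} * y {0, 1}
      + x {2, 3} * y {0, 2} - x {0, 1, 2} * y {0} + x {0, 2, 3} * y {2} ∧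
    contactBracket form4 x y {1, 2} = x ∅ * D (y {1, 2}) + (1/2 : ℂ) • (x {1} * D (y {2}))
      - (1/2 : ℂ) • (D (x {1}) * y {2}) - (1/2 : ℂ) • (x {2} * D (y {1}))
      + (1/2 : ℂ) • (D (x {2}) * y {1}) - D (x {1, 2}) * y ∅ + x {1} * y {0, 1, 2}
      + x {2} * y {1, 2, 3} - x {0, 1} * y {1, 2} - x {1, 2} * y {2, 3} + x {1, 2} * y {0, 1}
      + x {2, 3} * y {1, 2} + x {0, 1, 2} * y {1} + x {1, 2, 3} * y {2} ∧
    contactBracket form4 x y {0, 3} = x ∅ * D (y {0, 3}) + (1/2 : ℂ) • (x {0} * D (y {3}))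
      - (1/2 : ℂ) • (D (x {0}) * y {3}) - (1/2 : ℂ) • (x {3} * D (y {0}))
      + (1/2 : ℂ) • (D (x {3}) * y {0}) - D (x {0, 3}) * y ∅ - x {0} * y {0, 1, 3}
      - x {3} * y {0, 2, 3} + x {0, 1} * y {0, 3} + x {0, 3} * y {2, 3} - x {0, 3} * y {0, 1}
      - x {2, 3} * y {0, 3} - x {0, 1, 3} * y {0} - x {0, 2, 3} * y {3} ∧
    contactBracket form4 x y {1, 3} = x ∅ * D (y {1, 3}) + (1/2 : ℂ) • (x {1} * D (y {3}))
      - (1/2 : ℂ) • (D (x {1}) * y {3}) - (1/2 : ℂ) • (x {3} * D (y {1}))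
      + (1/2 : ℂ) • (D (x {3}) * y {1}) - D (x {1, 3}) * y ∅ + x {1} * y {0, 1, 3}
      - x {3} * y {1, 2, 3} - x {0, 1} * y {1, 3} + x {1, 3} * y {2, 3} + x {1, 3} * y {0, 1}
      - x {2, 3} * y {1, 3} + x {0, 1, 3} * y {1} - x {1, 2, 3} * y {3} ∧
    contactBracket form4 x y {2, 3} = x ∅ * D (y {2, 3}) + (1/2 : ℂ) • (x {2} * D (y {3}))
      - (1/2 : ℂ) • (D (x {2}) * y {3}) - (1/2 : ℂ) • (x {3} * D (y {2}))
      + (1/2 : ℂ) • (D (x {3}) * y {2}) - D (x {2, 3}) * y ∅ + x {0} * y {1, 2, 3}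
      + x {1} * y {0, 2, 3} - x {0, 2} * y {1, 3} + x {0, 3} * y {1, 2} - x {1, 2} * y {0, 3}
      + x {1, 3} * y {0, 2} + x {0, 2, 3} * y {1} + x {1, 2, 3} * y {0} := by
  refine ⟨?_, ?_, ?_, ?_, ?_, ?_⟩ <;>
  · simp [contactBracket_form4, mul4_01, mul4_02, mul4_12, mul4_03, mul4_13, mul4_23,
        partialD4_0, partialD4_1, partialD4_2, partialD4_3, partialD_of_mem, parity, dt,
        halfEuler_zero, halfEuler_one, halfEuler_two, smul_eq_C_mul]
    ring

theorem contactBracket_form4_degree_three (x y : Grass 4) :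
    contactBracket form4 x y {0, 1, 2} = x ∅ * D (y {0, 1, 2})
      + (1/2 : ℂ) • (D (x ∅) * y {0, 1, 2}) + (1/2 : ℂ) • (x {0} * D (y {1, 2}))
      - (1/2 : ℂ) • (x {1} * D (y {0, 2})) + (1/2 : ℂ) • (x {2} * D (y {0, 1}))
      - (1/2 : ℂ) • (D (x {0, 1}) * y {2}) + (1/2 : ℂ) • (D (x {0, 2}) * y {1})
      - (1/2 : ℂ) • (D (x {1, 2}) * y {0}) - (1/2 : ℂ) • (x {0, 1, 2} * D (y ∅))
      - D (x {0, 1, 2}) * y ∅ - x {2} * y {0, 1, 2, 3} + x {0, 2} * y {1, 2, 3}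
      - x {1, 2} * y {0, 2, 3} + x {2, 3} * y {0, 1, 2} - x {0, 1, 2} * y {2, 3}
      + x {0, 2, 3} * y {1, 2} - x {1, 2, 3} * y {0, 2} + x {0, 1, 2, 3} * y {2} ∧
    contactBracket form4 x y {0, 1, 3} = x ∅ * D (y {0, 1, 3})
      + (1/2 : ℂ) • (D (x ∅) * y {0, 1, 3}) + (1/2 : ℂ) • (x {0} * D (y {1, 3}))
      - (1/2 : ℂ) • (x {1} * D (y {0, 3})) + (1/2 : ℂ) • (x {3} * D (y {0, 1}))
      - (1/2 : ℂ) • (D (x {0, 1}) * y {3}) + (1/2 : ℂ) • (D (x {0, 3}) * y {1})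
      - (1/2 : ℂ) • (D (x {1, 3}) * y {0}) - (1/2 : ℂ) • (x {0, 1, 3} * D (y ∅))
      - D (x {0, 1, 3}) * y ∅ + x {3} * y {0, 1, 2, 3} - x {0, 3} * y {1, 2, 3}
      + x {1, 3} * y {0, 2, 3} - x {2, 3} * y {0, 1, 3} + x {0, 1, 3} * y {2, 3}
      - x {0, 2, 3} * y {1, 3} + x {1, 2, 3} * y {0, 3} - x {0, 1, 2, 3} * y {3} ∧
    contactBracket form4 x y {0, 2, 3} = x ∅ * D (y {0, 2, 3})
      + (1/2 : ℂ) • (D (x ∅) * y {0, 2, 3}) + (1/2 : ℂ) • (x {0} * D (y {2, 3}))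
      - (1/2 : ℂ) • (x {2} * D (y {0, 3})) + (1/2 : ℂ) • (x {3} * D (y {0, 2}))
      - (1/2 : ℂ) • (D (x {0, 2}) * y {3}) + (1/2 : ℂ) • (D (x {0, 3}) * y {2})
      - (1/2 : ℂ) • (D (x {2, 3}) * y {0}) - (1/2 : ℂ) • (x {0, 2, 3} * D (y ∅))
      - D (x {0, 2, 3}) * y ∅ - x {0} * y {0, 1, 2, 3} + x {0, 1} * y {0, 2, 3}
      - x {0, 2} * y {0, 1, 3} + x {0, 3} * y {0, 1, 2} - x {0, 1, 2} * y {0, 3}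
      + x {0, 1, 3} * y {0, 2} - x {0, 2, 3} * y {0, 1} + x {0, 1, 2, 3} * y {0} ∧
    contactBracket form4 x y {1, 2, 3} = x ∅ * D (y {1, 2, 3})
      + (1/2 : ℂ) • (D (x ∅) * y {1, 2, 3}) + (1/2 : ℂ) • (x {1} * D (y {2, 3}))
      - (1/2 : ℂ) • (x {2} * D (y {1, 3})) + (1/2 : ℂ) • (x {3} * D (y {1, 2}))
      - (1/2 : ℂ) • (D (x {1, 2}) * y {3}) + (1/2 : ℂ) • (D (x {1, 3}) * y {2})
      - (1/2 : ℂ) • (D (x {2, 3}) * y {1}) - (1/2 : ℂ) • (x {1, 2, 3} * D (y ∅))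
      - D (x {1, 2, 3}) * y ∅ + x {1} * y {0, 1, 2, 3} - x {0, 1} * y {1, 2, 3}
      + x {1, 2} * y {0, 1, 3} - x {1, 3} * y {0, 1, 2} + x {0, 1, 2} * y {1, 3}
      - x {0, 1, 3} * y {1, 2} + x {1, 2, 3} * y {0, 1} - x {0, 1, 2, 3} * y {1} := by
  refine ⟨?_, ?_, ?_, ?_⟩ <;>
  · simp [contactBracket_form4, mul4_012, mul4_013, mul4_023, mul4_123, partialD4_0,
        partialD4_1, partialD4_2, partialD4_3, partialD_of_mem, parity, dt, halfEuler_zero,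
        halfEuler_one, halfEuler_two, halfEuler_three, smul_eq_C_mul]
    ring

/-- The coefficient of `ω = ζ₁η₁ζ₂η₂` in `(1 - E/2)(x) y`, where `E` is the Euler derivation; its
constant term is the cocycle `ψ(x, y)`. -/
theorem mul_halfEuler_univ (x y : Grass 4) : mul (halfEuler x) y Finset.univ =
    x ∅ * y {0, 1, 2, 3} - x {0, 1, 2, 3} * y ∅ +
      (1/2 : ℂ) • (x {0} * y {1, 2, 3} - x {1} * y {0, 2, 3} + x {2} * y {0, 1, 3}
        - x {3} * y {0, 1, 2} - x {0, 1, 2} * y {3} + x {0, 1, 3} * y {2} - x {0, 2, 3} * y {1}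
        + x {1, 2, 3} * y {0}) := by
  rw [show (Finset.univ : Finset (Fin 4)) = {0, 1, 2, 3} from rfl]
  simp [mul4_0123, halfEuler_zero, halfEuler_one, halfEuler_two, halfEuler_three, halfEuler_four,
    smul_eq_C_mul]
  ring

/-- The Poisson bracket has no component along `ω`, and the remaining terms of the contact bracket
form a total derivative. This accounts for the cocycle: it is the constant term of a primitive of
the coefficient of `ω` in the bracket. -/
theorem contactBracket_form4_univ (x y : Grass 4) :
    contactBracket form4 x y Finset.univ = D (mul (halfEuler x) y Finset.univ) := by
  rw [mul_halfEuler_univ, show (Finset.univ : Finset (Fin 4)) = {0, 1, 2, 3} from rfl]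
  simp [contactBracket_form4, mul4_0123, partialD4_0, partialD4_1, partialD4_2, partialD4_3,
    partialD_of_mem, parity, dt, halfEuler_zero, halfEuler_one, halfEuler_two, halfEuler_three,
    halfEuler_four, D_mul, smul_eq_C_mul, D_C]
  ring

end Grass

/-! ### The derived algebra of `K(4; D)` -/

namespace Grass

variable {N : ℕ} {τ : Sector} {x y : Grass N}

/-- The elements of `Grass N` whose component of degree `d` has its coefficients in the space
`τ.coeff (d + k)`. This is `KD N τ` for `k = 0`; for `k = 1` it contains the images of `KD N τ` by
the odd derivations. -/
def coeffSpace (τ : Sector) (N k : ℕ) : Submodule ℂ (Grass N) where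
  carrier := {x | ∀ S : Finset (Fin N), x S ∈ τ.coeff (S.card + k)}
  add_mem' hx hy S := add_mem (hx S) (hy S)
  zero_mem' _ := zero_mem _
  smul_mem' r _ hx S := Submodule.smul_mem _ r (hx S)

theorem mul_mem_coeffSpace {k l : ℕ} (hx : x ∈ coeffSpace τ N k) (hy : y ∈ coeffSpace τ N l) :
    mul x y ∈ coeffSpace τ N (k + l) := by
  intro U
  refine Submodule.sum_mem _ fun S hS => zsmul_mem ?_ _
  have h := Sector.mul_mem_coeff (hx S) (hy (U \ S))
  have hc := Finset.card_sdiff_add_card_eq_card (Finset.mem_powerset.1 hS)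
  rwa [show S.card + k + ((U \ S).card + l) = U.card + (k + l) by lia] at h

theorem partialD_mem_coeffSpace {k : ℕ} (i : Fin N) (hx : x ∈ coeffSpace τ N k) :
    partialD i x ∈ coeffSpace τ N (k + 1) := by
  intro U
  by_cases hi : i ∈ U
  · rw [partialD, if_pos hi]
    exact zero_mem _
  · rw [partialD, if_neg hi]
    have h := hx (insert i U)
    rw [Finset.card_insert_of_notMem hi, show U.card + 1 + k = U.card + (k + 1) by lia] at h
    exact zsmul_mem h _

theorem coeffSpace_zero (τ : Sector) (N : ℕ) : coeffSpace τ N 0 = KD N τ := rfl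

theorem coeffSpace_two (τ : Sector) (N : ℕ) : coeffSpace τ N (1 + 1) = KD N τ := by
  have h (S : Finset (Fin N)) : τ.coeff (S.card + (1 + 1)) = τ.coeff S.card :=
    τ.coeff_congr (by simp [parity_simps])
  ext z
  exact forall_congr' fun S => by rw [h]

theorem contactBracket_mem_KD (g : Matrix (Fin N) (Fin N) ℂ) (hx : x ∈ KD N τ)
    (hy : y ∈ KD N τ) : contactBracket g x y ∈ KD N τ := by
  have dt_mem {z : Grass N} (hz : z ∈ KD N τ) : dt z ∈ coeffSpace τ N 0 :=
    fun S => Sector.D_mem_coeff (hz S)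
  have half_mem {z : Grass N} (hz : z ∈ KD N τ) : halfEuler z ∈ coeffSpace τ N 0 :=
    fun S => Submodule.smul_mem _ _ (hz S)
  have parity_mem : parity x ∈ coeffSpace τ N 0 := fun S => zsmul_mem (hx S) _
  have h1 := mul_mem_coeffSpace (half_mem hx) (dt_mem hy)
  have h2 := mul_mem_coeffSpace (dt_mem hx) (half_mem hy)
  have h3 (i j : Fin N) := mul_mem_coeffSpace (partialD_mem_coeffSpace i parity_mem)
    (partialD_mem_coeffSpace j ((coeffSpace_zero τ N).symm ▸ hy))
  simp only [add_zero, zero_add, coeffSpace_zero, coeffSpace_two] at h1 h2 h3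
  exact sub_mem (sub_mem h1 h2) (Submodule.sum_mem _ fun i _ => Submodule.sum_mem _ fun j _ =>
    Submodule.smul_mem _ _ (h3 i j))

theorem mul_single_empty (f : HalfLaurent) (y : Grass N) (U : Finset (Fin N)) :
    mul (Pi.single ∅ f) y U = f * y U := by
  rw [mul, Finset.sum_eq_single ∅]
  · rw [Pi.single_eq_same, Finset.sdiff_empty, koszulSign]
    simp
  · intro S _ hS
    rw [Pi.single_eq_of_ne hS, zero_mul, smul_zero]
  · simp

/-- The action of `f D` on the densities `ξ_S ⊗ g D^{(2-|S|)/2}`. -/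
theorem contactBracket_contactVir (g : Matrix (Fin N) (Fin N) ℂ) (f : HalfLaurent) (y : Grass N)
    (S : Finset (Fin N)) : contactBracket g (contactVir f) y S =
      f * D (y S) - ((2 - (S.card : ℂ)) / 2) • (D f * y S) := by
  have h1 : halfEuler (contactVir f : Grass N) = Pi.single ∅ f := by
    ext1 U
    by_cases hU : U = ∅
    · subst hU
      simp [halfEuler, contactVir]
    · simp [halfEuler, contactVir, hU]
  have h2 : dt (contactVir f : Grass N) = Pi.single ∅ (D f) := by
    ext1 U
    by_cases hU : U = ∅
    · subst hU
      simp [dt, contactVir]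
    · simp [dt, contactVir, hU]
  have h3 (i : Fin N) : partialD i (parity (contactVir f : Grass N)) = 0 := by
    ext1 U
    simp [partialD, parity, contactVir]
  have h4 (z : Grass N) : mul 0 z = 0 := by
    ext1 U
    simp [mul]
  simp only [contactBracket, h1, h2, h3, h4, smul_zero, Finset.sum_const_zero, sub_zero,
    Pi.sub_apply, Pi.zero_apply, mul_single_empty]
  rw [dt, halfEuler, mul_smul_comm]

end Grass

open Grass

theorem contactVir_mem_KD {N : ℕ} (τ : Sector) {f : HalfLaurent} (hf : f ∈ integralPowers) :
    (contactVir f : Grass N) ∈ KD N τ := by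
  intro S
  by_cases hS : S = ∅
  · subst hS
    simpa [contactVir] using (mem_integralPowers τ).1 hf
  · rw [contactVir, Pi.single_eq_of_ne hS]
    exact zero_mem _

theorem single_mem_KD {N : ℕ} {τ : Sector} {S : Finset (Fin N)} {f : HalfLaurent}
    (hf : f ∈ τ.coeff S.card) : (Pi.single S f : Grass N) ∈ KD N τ := by
  intro U
  by_cases hU : U = S
  · subst hU
    rwa [Pi.single_eq_same]
  · rw [Pi.single_eq_of_ne hU]
    exact zero_mem _

/-- The part `ξ_S ⊗ D g` of `ξ_S ⊗ f` with `D g` in the image of `D` is `[D, ξ_S ⊗ g]`; the constant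
part is a multiple of `[t⁻¹ D, ξ_S ⊗ t]`, unless `S` is everything. -/
theorem single_mem_K4 {τ : Sector} {S : Finset (Fin 4)} {f : HalfLaurent}
    (hf : f ∈ τ.coeff S.card) (h0 : S = Finset.univ → f.coeff 0 = 0) :
    (Pi.single S f : Grass 4) ∈ K4 τ := by
  have vir_mem (n : ℤ) : contactVir (T (2 * n)) ∈ KD 4 τ :=
    contactVir_mem_KD τ (Submodule.subset_span ⟨n, rfl⟩)
  have hD : (Pi.single S (D (antiD f)) : Grass 4) ∈ K4 τ := by
    refine Submodule.subset_span ⟨_, vir_mem 0, _, single_mem_KD (Sector.antiD_mem_coeff hf), ?_⟩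
    ext1 U
    change _ = contactBracket _ _ _ _
    rw [contactBracket_contactVir]
    by_cases hU : U = S
    · subst hU
      simp
    · simp [hU]
  have hC : (Pi.single S (C (f.coeff 0)) : Grass 4) ∈ K4 τ := by
    by_cases hS : S = Finset.univ
    · rw [h0 hS]
      simp
    -- `[t⁻¹ D, ξ_S ⊗ t] = (2 - |S|/2) ξ_S`, and the factor vanishes only for `|S| = 4`.
    have hr : (2 : ℂ) - S.card / 2 ≠ 0 := by
      have h4 : S.card ≠ 4 := fun h => hS (Finset.card_eq_iff_eq_univ S |>.1 (by simpa using h))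
      intro h
      apply h4
      have : (S.card : ℂ) = 4 := by linear_combination -2 * h
      exact_mod_cast this
    have hmem : (2 - (S.card : ℂ) / 2)⁻¹ • (C (f.coeff 0) * T (2 * 1)) ∈ τ.coeff S.card := by
      have := Sector.mul_mem_coeff (Sector.C_coeff_zero_mem_coeff hf) (T_two_mul_mem τ 1)
      exact Submodule.smul_mem _ _ (by simpa using this)
    refine Submodule.subset_span ⟨_, vir_mem (-1), _, single_mem_KD hmem, ?_⟩
    ext1 U
    change _ = contactBracket _ _ _ _
    rw [contactBracket_contactVir]
    by_cases hU : U = S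
    · subst hU
      have hT : (T (2 * -1) * (C (f.coeff 0) * T (2 * 1)) : HalfLaurent) = C (f.coeff 0) := by
        rw [mul_left_comm, ← T_add]
        simp
      have hs : (2 - (U.card : ℂ) / 2)⁻¹ -
          (2 - (U.card : ℂ)) / 2 * (-(2 - (U.card : ℂ) / 2)⁻¹) = 1 := by
        linear_combination mul_inv_cancel₀ hr
      simp only [Pi.single_eq_same, map_smul, D_mul, D_C, D_T, zero_mul, zero_add, smul_mul_assoc,
        mul_smul_comm, hT, smul_smul]
      rw [← sub_smul]
      convert (one_smul ℂ _).symm using 2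
      rw [← hs]
      push_cast
      ring
    · simp [hU]
  rw [← D_antiD f, Pi.single_add]
  exact add_mem hD hC

/-- The derived algebra of `K(4; D)` is cut out by one condition: the coefficient of `ω` has no
constant term. -/
theorem mem_K4_iff {τ : Sector} {x : Grass 4} :
    x ∈ K4 τ ↔ x ∈ KD 4 τ ∧ (x Finset.univ).coeff 0 = 0 := by
  constructor
  · intro hx
    induction hx using Submodule.span_induction with
    | mem z hz =>
      obtain ⟨x, hx, y, hy, rfl⟩ := hz
      refine ⟨contactBracket_mem_KD form4 hx hy, ?_⟩
      change (contactBracket form4 x y Finset.univ).coeff 0 = 0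
      rw [contactBracket_form4_univ, coeff_zero_D]
    | zero => exact ⟨zero_mem _, rfl⟩
    | add x y _ _ hx hy =>
      refine ⟨add_mem hx.1 hy.1, ?_⟩
      rw [Pi.add_apply, AddMonoidAlgebra.coeff_add, Finsupp.add_apply, hx.2, hy.2, add_zero]
    | smul r x _ hx =>
      refine ⟨Submodule.smul_mem _ r hx.1, ?_⟩
      rw [Pi.smul_apply, AddMonoidAlgebra.coeff_smul, Finsupp.smul_apply, hx.2, smul_zero]
  · rintro ⟨hx, h0⟩
    rw [← Finset.univ_sum_single x]
    exact Submodule.sum_mem _ fun S _ => single_mem_K4 (hx S) fun hS => hS ▸ h0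

/-! ### The homomorphism from `K̂(4)` to `CK(6)` -/

/-- An equality of Laurent polynomials can be tested in the fields which are algebras over `ℂ`, the
fraction field being one of them. There, unlike in `HalfLaurent`, `ring` can divide by integers. -/
theorem eq_of_forall_algHom {a b : HalfLaurent}
    (h : ∀ (K : Type) [Field K] [CharZero K] [Algebra ℂ K] (φ : HalfLaurent →ₐ[ℂ] K), φ a = φ b) :
    a = b := by
  have := charZero_of_injective_algebraMap (algebraMap ℂ (FractionRing HalfLaurent)).injective
  exact IsFractionRing.injective HalfLaurent (FractionRing HalfLaurent)
    (h (FractionRing HalfLaurent) (IsScalarTower.toAlgHom ℂ _ _))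

theorem map_C_eq {K : Type} [Field K] [Algebra ℂ K] (φ : HalfLaurent →ₐ[ℂ] K) (r : ℂ) :
    φ (C r) = algebraMap ℂ K r := by
  rw [C_eq_algebraMap, φ.commutes]

theorem mulOp_apply (f g : HalfLaurent) : mulOp f g = f * g := rfl

theorem Mat8.superCommutator_fromBlocks (A B C E A' B' C' E' : Matrix (Fin 4) (Fin 4) Op) :
    Mat8.superCommutator (fromBlocks A B C E) (fromBlocks A' B' C' E') =
      fromBlocks (A * A' + B * C' - A' * A + B' * C) (A * B' + B * E' - A' * B - B' * E)
        (C * A' + E * C' - C' * A - E' * C) (C * B' + E * E' - E' * E + C' * B) := by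
  rw [Mat8.superCommutator, Mat8.evenPart, Mat8.evenPart, Mat8.oddPart, Mat8.oddPart]
  simp only [toBlocks_fromBlocks₁₁, toBlocks_fromBlocks₁₂, toBlocks_fromBlocks₂₁,
    toBlocks_fromBlocks₂₂, fromBlocks_multiply, fromBlocks_neg, fromBlocks_add, sub_eq_add_neg,
    neg_zero, mul_zero, add_zero, zero_add, Matrix.neg_mul, neg_neg]
  congr 1
  all_goals abel

/-- The block `a` of the image of `x ∈ Grass 4` and of the current `h`. The eigenspaces of `c` on `V`
are the planes spanned by the first two and by the last two basis vectors; the components of degree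
two in the `ξ_i` form `𝔰𝔬(4) = 𝔰𝔩(2) ⊕ 𝔰𝔩(2)`, which acts on these planes, and `h` is the coefficient
of `c = diag(1, 1, -1, -1)`. -/
def blockA (x : Grass 4) (h : HalfLaurent) : Matrix (Fin 4) (Fin 4) HalfLaurent :=
  !![(1/2 : ℂ) • (x {0, 1} + x {2, 3}) + h, x {0, 2}, 0, 0;
     -x {1, 3}, -((1/2 : ℂ) • (x {0, 1} + x {2, 3})) + h, 0, 0;
     0, 0, (1/2 : ℂ) • (x {0, 1} - x {2, 3}) - h, x {0, 3};
     0, 0, -x {1, 2}, -((1/2 : ℂ) • (x {0, 1} - x {2, 3})) - h]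

/-- The block `b` of the image of `x`: the degree one part of `x`, as a skew-symmetric matrix of weight
zero for `c`. Its Pfaffian `x {0} x {1} + x {2} x {3}` polarizes to the form `form4` of `K(4)`. -/
def blockB (x : Grass 4) : Matrix (Fin 4) (Fin 4) HalfLaurent :=
  !![0, 0, x {0}, x {2};
     0, 0, x {3}, -x {1};
     -x {0}, -x {3}, 0, 0;
     -x {2}, x {1}, 0, 0]

/-- The block `h` of the image of `x`: the degree three part of `x`, as a symmetric matrix of weight
zero for `c`. -/
def blockH (x : Grass 4) : Matrix (Fin 4) (Fin 4) HalfLaurent :=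
  !![0, 0, x {1, 2, 3}, x {0, 1, 3};
     0, 0, -x {0, 1, 2}, x {0, 2, 3};
     x {1, 2, 3}, -x {0, 1, 2}, 0, 0;
     x {0, 1, 3}, x {0, 2, 3}, 0, 0]

/-- The matrix attached to `x ∈ Grass 4` and to a current `h`. It does not involve the coefficient of
`ω` in `x`, which is meant to be `D h`. -/
def toCK (x : Grass 4) (h : HalfLaurent) : Mat8 :=
  ckMatrix (x ∅) (blockA x h) (blockB x) (blockH x)

set_option maxHeartbeats 4000000 in
/-- `toCK` is a homomorphism on the pairs `(x, h)` for which `D h` is the coefficient of `ω` in `x`.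
By `contactBracket_form4_univ`, the right-hand side is of this form too. The proof compares the
entries of the two matrices of operators on an arbitrary function `u`. -/
theorem superCommutator_toCK {x y : Grass 4} {h k : HalfLaurent} (hx : D h = x Finset.univ)
    (hy : D k = y Finset.univ) :
    Mat8.superCommutator (toCK x h) (toCK y k) =
      toCK (contactBracket form4 x y) (mul (halfEuler x) y Finset.univ) := by
  rw [mul_halfEuler_univ]
  replace hx : x {0, 1, 2, 3} = D h := hx.symm
  replace hy : y {0, 1, 2, 3} = D k := hy.symm
  simp only [toCK, ckMatrix, Mat8.superCommutator_fromBlocks]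
  congr 1
  all_goals
    ext1 i j
    refine LinearMap.ext fun u => ?_
    fin_cases i <;> fin_cases j <;>
    -- The entries which are zero by weight disappear at this step.
    simp only [blockA, blockB, blockH, phi, of_apply, cons_val', cons_val, cons_val_fin_one,
      cons_val_one, cons_val_zero, Fin.isValue, Fin.zero_eta, Fin.mk_one, Fin.reduceFinMk,
      Fin.reduceEq, Matrix.add_apply, Matrix.sub_apply, Matrix.neg_apply, transpose_apply,
      mul_apply, map_apply, Fin.sum_univ_four, diagonal_apply_eq, diagonal_apply_ne, ne_eq,
      zero_ne_one, one_ne_zero, not_false_eq_true, one_div, map_add, map_sub, map_neg, map_smul,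
      map_zero, smul_add, smul_neg, smul_zero, neg_add_rev, neg_sub, neg_neg, neg_zero, add_zero,
      zero_add, mul_zero, zero_mul, sub_self, LinearMap.add_apply, LinearMap.sub_apply,
      LinearMap.neg_apply, LinearMap.smul_apply, LinearMap.zero_apply, Module.End.mul_apply] <;>
    · simp only [contactBracket_form4_degree_zero, contactBracket_form4_degree_one,
        contactBracket_form4_degree_two, contactBracket_form4_degree_three, mulOp_apply, hx, hy]
      simp only [D_mul, D_C, map_add, map_sub, smul_eq_C_mul]
      refine eq_of_forall_algHom fun K _ _ _ φ => ?_
      simp only [map_C_eq, map_add, map_sub, map_neg, map_mul, map_one, map_zero, map_div₀, map_inv₀,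
        map_ofNat (algebraMap ℂ K)]
      ring

/-! ### The embedding of `K(3)` in `K̂(4)` -/

theorem finset_three_cases : ∀ S : Finset (Fin 3), S = ∅ ∨ S = {0} ∨ S = {1} ∨ S = {2} ∨
    S = {0, 1} ∨ S = {0, 2} ∨ S = {1, 2} ∨ S = {0, 1, 2} := by
  decide

theorem finset_four_cases : ∀ S : Finset (Fin 4), S = ∅ ∨ S = {0} ∨ S = {1} ∨ S = {2} ∨ S = {3} ∨
    S = {0, 1} ∨ S = {0, 2} ∨ S = {0, 3} ∨ S = {1, 2} ∨ S = {1, 3} ∨ S = {2, 3} ∨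
    S = {0, 1, 2} ∨ S = {0, 1, 3} ∨ S = {0, 2, 3} ∨ S = {1, 2, 3} ∨ S = Finset.univ := by
  decide

/-- The substitution `ξ_0 = ζ₁ + η₁/2`, `ξ_1 = i (ζ₁ - η₁/2)`, `ξ_2 = ζ₂ + η₂/2`. These three odd
variables are orthonormal for the form of `K(4)`. -/
def subst (x : Grass 3) : Grass 4 :=
  Pi.single ∅ (x ∅) + Pi.single {0} (x {0} + Complex.I • x {1}) +
    Pi.single {1} ((1/2 : ℂ) • (x {0} - Complex.I • x {1})) + Pi.single {2} (x {2}) +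
    Pi.single {3} ((1/2 : ℂ) • x {2}) + Pi.single {0, 1} (-(Complex.I • x {0, 1})) +
    Pi.single {0, 2} (x {0, 2} + Complex.I • x {1, 2}) +
    Pi.single {0, 3} ((1/2 : ℂ) • (x {0, 2} + Complex.I • x {1, 2})) +
    Pi.single {1, 2} ((1/2 : ℂ) • (x {0, 2} - Complex.I • x {1, 2})) +
    Pi.single {1, 3} ((1/4 : ℂ) • (x {0, 2} - Complex.I • x {1, 2})) +
    Pi.single {0, 1, 2} (-(Complex.I • x {0, 1, 2})) +
    Pi.single {0, 1, 3} ((1/2 : ℂ) • -(Complex.I • x {0, 1, 2}))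

theorem subst_apply (x : Grass 3) :
    subst x ∅ = x ∅ ∧ subst x {0} = x {0} + Complex.I • x {1} ∧
    subst x {1} = (1/2 : ℂ) • (x {0} - Complex.I • x {1}) ∧ subst x {2} = x {2} ∧
    subst x {3} = (1/2 : ℂ) • x {2} ∧ subst x {0, 1} = -(Complex.I • x {0, 1}) ∧
    subst x {0, 2} = x {0, 2} + Complex.I • x {1, 2} ∧
    subst x {0, 3} = (1/2 : ℂ) • (x {0, 2} + Complex.I • x {1, 2}) ∧
    subst x {1, 2} = (1/2 : ℂ) • (x {0, 2} - Complex.I • x {1, 2}) ∧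
    subst x {1, 3} = (1/4 : ℂ) • (x {0, 2} - Complex.I • x {1, 2}) ∧ subst x {2, 3} = 0 ∧
    subst x {0, 1, 2} = -(Complex.I • x {0, 1, 2}) ∧
    subst x {0, 1, 3} = (1/2 : ℂ) • -(Complex.I • x {0, 1, 2}) ∧ subst x {0, 2, 3} = 0 ∧
    subst x {1, 2, 3} = 0 ∧ subst x {0, 1, 2, 3} = 0 := by
  refine ⟨?_, ?_, ?_, ?_, ?_, ?_, ?_, ?_, ?_, ?_, ?_, ?_, ?_, ?_, ?_, ?_⟩ <;>
    simp +decide only [subst, Pi.add_apply, Pi.single_apply, if_true, if_false, add_zero, zero_add]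

theorem subst_univ (x : Grass 3) : subst x Finset.univ = 0 :=
  (subst_apply x).2.2.2.2.2.2.2.2.2.2.2.2.2.2.2

/-- The cocycle `ψ` vanishes on the image of `K(3)`: products of elements of a Grassmann algebra on
three variables have no component of degree four. -/
theorem mul_halfEuler_subst (x y : Grass 3) :
    mul (halfEuler (subst x)) (subst y) Finset.univ = 0 := by
  rw [mul_halfEuler_univ]
  simp only [subst_apply, smul_eq_C_mul]
  ring

set_option maxHeartbeats 1000000 in
theorem contactBracket_subst (x y : Grass 3) :
    contactBracket form4 (subst x) (subst y) = subst (contactBracket form3 x y) := by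
  have hI : (C Complex.I : HalfLaurent) ^ 2 = -1 := by
    rw [← map_pow, Complex.I_sq, map_neg, map_one]
  have hu : contactBracket form4 (subst x) (subst y) Finset.univ =
      subst (contactBracket form3 x y) Finset.univ := by
    rw [subst_univ, contactBracket_form4_univ, mul_halfEuler_subst, map_zero]
  ext1 S
  rcases finset_four_cases S with rfl | rfl | rfl | rfl | rfl | rfl | rfl | rfl | rfl | rfl | rfl |
    rfl | rfl | rfl | rfl | rfl
  on_goal 16 => exact hu
  all_goals
    simp only [subst_apply, contactBracket_form4_degree_zero, contactBracket_form4_degree_one,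
      contactBracket_form4_degree_two, contactBracket_form4_degree_three,
      contactBracket_form3_degree_zero, contactBracket_form3_degree_one,
      contactBracket_form3_degree_two, contactBracket_form3_degree_three, D_mul, D_C, map_add,
      map_sub, map_neg, map_zero, smul_eq_C_mul]
    refine eq_of_forall_algHom fun K _ _ _ φ => ?_
    replace hI := congrArg φ hI
    simp only [map_C_eq, map_add, map_sub, map_neg, map_mul, map_one, map_zero, map_div₀,
        map_ofNat (algebraMap ℂ K), map_pow] at hI ⊢
    -- Some of the components do not involve `i ^ 2`.
    ring_nf
    try simp only [hI]
    try ring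

theorem subst_mem_KD {τ : Sector} {x : Grass 3} (hx : x ∈ K3 τ) : subst x ∈ KD 4 τ := by
  have h0 := hx ∅
  have h1 (i : Fin 3) : x {i} ∈ τ.coeff 1 := hx {i}
  have h01 := hx {0, 1}
  have h02 := hx {0, 2}
  have h12 := hx {1, 2}
  have h012 := hx {0, 1, 2}
  have smul_mem {k : ℕ} {r : ℂ} {f : HalfLaurent} : f ∈ τ.coeff k → r • f ∈ τ.coeff k :=
    Submodule.smul_mem _ r
  refine add_mem (add_mem (add_mem (add_mem (add_mem (add_mem (add_mem (add_mem (add_mem (add_mem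
    (add_mem ?_ ?_) ?_) ?_) ?_) ?_) ?_) ?_) ?_) ?_) ?_) ?_ <;> refine single_mem_KD ?_
  · exact h0
  · exact add_mem (h1 0) (smul_mem (h1 1))
  · exact smul_mem (sub_mem (h1 0) (smul_mem (h1 1)))
  · exact h1 2
  · exact smul_mem (h1 2)
  · exact neg_mem (smul_mem h01)
  · exact add_mem h02 (smul_mem h12)
  · exact smul_mem (add_mem h02 (smul_mem h12))
  · exact smul_mem (sub_mem h02 (smul_mem h12))
  · exact smul_mem (sub_mem h02 (smul_mem h12))
  · exact neg_mem (smul_mem h012)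
  · exact smul_mem (neg_mem (smul_mem h012))

/-- The substitution as a linear map from `K(3)` to `K̂(4)`; no central term is needed. -/
def substHat (τ : Sector) : K3 τ →ₗ[ℂ] KHat4 τ where
  toFun x := ⟨(subst x, 0), mem_K4_iff.2 ⟨subst_mem_KD x.2,
    congrArg (fun f => f.coeff 0) (subst_univ x)⟩, trivial⟩
  map_add' x y := by
    refine Subtype.ext (Prod.ext ?_ (add_zero _).symm)
    ext1 S
    rcases finset_four_cases S with rfl | rfl | rfl | rfl | rfl | rfl | rfl | rfl | rfl | rfl | rfl |
      rfl | rfl | rfl | rfl | rfl <;>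
      simp [subst_apply, subst_univ] <;> module
  map_smul' r x := by
    refine Subtype.ext (Prod.ext ?_ (smul_zero _).symm)
    ext1 S
    rcases finset_four_cases S with rfl | rfl | rfl | rfl | rfl | rfl | rfl | rfl | rfl | rfl | rfl |
      rfl | rfl | rfl | rfl | rfl <;>
      simp [subst_apply, subst_univ] <;> module

theorem substHat_injective (τ : Sector) : Function.Injective (substHat τ) := by
  rw [injective_iff_map_eq_zero]
  intro x hx
  replace hx (S : Finset (Fin 4)) : subst x S = 0 := congrFun (congrArg (fun z => z.1.1) hx) S
  have hsum {f g : HalfLaurent} {r : ℂ} (hr : r ≠ 0) (h : f + Complex.I • g = 0)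
      (h' : r • (f - Complex.I • g) = 0) : f = 0 ∧ g = 0 := by
    have h'' := (smul_eq_zero.1 h').resolve_left hr
    have hf : (2 : ℂ) • f = 0 := by linear_combination (norm := module) h + h''
    have hf := (smul_eq_zero.1 hf).resolve_left two_ne_zero
    rw [hf, zero_add] at h
    exact ⟨hf, (smul_eq_zero.1 h).resolve_left Complex.I_ne_zero⟩
  have hneg {f : HalfLaurent} (h : -(Complex.I • f) = 0) : f = 0 :=
    (smul_eq_zero.1 (neg_eq_zero.1 h)).resolve_left Complex.I_ne_zero
  obtain ⟨e, e0, e1, e2, -, e01, e02, -, -, e13, -, e012, -⟩ := subst_apply (x : Grass 3)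
  rw [hx] at e e0 e1 e2 e01 e02 e13 e012
  have h01 := hsum (by norm_num) e0.symm e1.symm
  have h12 := hsum (by norm_num) e02.symm e13.symm
  refine Subtype.ext (funext fun S => ?_)
  rcases finset_three_cases S with rfl | rfl | rfl | rfl | rfl | rfl | rfl | rfl
  exacts [e.symm, h01.1, h01.2, e2.symm, hneg e01.symm, h12.1, h12.2, hneg e012.symm]

theorem isSuperHom_substHat (τ : Sector) :
    IsSuperHom (contact form3) contactHat (substHat τ) where
  map_even x hx := by
    refine ⟨fun S hS => ?_, trivial⟩
    have h0 := hx {0} (by decide)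
    have h1 := hx {1} (by decide)
    have h2 := hx {2} (by decide)
    have h012 := hx {0, 1, 2} (by decide)
    change subst x S = 0
    rcases finset_four_cases S with rfl | rfl | rfl | rfl | rfl | rfl | rfl | rfl | rfl | rfl | rfl |
      rfl | rfl | rfl | rfl | rfl <;>
      first
      | exact absurd hS (by decide)
      | simp [subst_apply, h0, h1, h2, h012]
  map_odd x hx := by
    refine ⟨fun S hS => ?_, rfl⟩
    have h := hx ∅ (by decide)
    have h01 := hx {0, 1} (by decide)
    have h02 := hx {0, 2} (by decide)
    have h12 := hx {1, 2} (by decide)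
    change subst x S = 0
    rcases finset_four_cases S with rfl | rfl | rfl | rfl | rfl | rfl | rfl | rfl | rfl | rfl | rfl |
      rfl | rfl | rfl | rfl | rfl <;>
      first
      | exact absurd hS (by decide)
      | simp [subst_apply, subst_univ, h, h01, h02, h12]
  map_br x y := by
    refine ⟨contactBracket_mem_KD form3 x.2 y.2, ?_⟩
    change (subst (contactBracket form3 x y), (0 : ℂ)) =
      (contactBracket form4 (subst x) (subst y), psi (subst x) (subst y))
    rw [contactBracket_subst, psi, mul_halfEuler_subst]
    rfl

theorem preservesVir_substHat (τ : Sector) :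
    PreservesVir contactVir contactHatVir (substHat τ) := by
  refine fun f hf => ⟨contactVir_mem_KD τ hf, Prod.ext ?_ rfl⟩
  change subst (contactVir f) = contactVir f
  ext1 S
  rcases finset_four_cases S with rfl | rfl | rfl | rfl | rfl | rfl | rfl | rfl | rfl | rfl | rfl |
    rfl | rfl | rfl | rfl | rfl <;>
    simp +decide [subst_apply, subst_univ, contactVir]

/-! ### The embedding of `K̂(4)` in `CK(6)` -/

theorem blockA_add (x y : Grass 4) (h k : HalfLaurent) :
    blockA (x + y) (h + k) = blockA x h + blockA y k := by
  ext1 i j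
  fin_cases i <;> fin_cases j <;> simp [blockA] <;> module

theorem blockA_smul (r : ℂ) (x : Grass 4) (h : HalfLaurent) :
    blockA (r • x) (r • h) = r • blockA x h := by
  ext1 i j
  fin_cases i <;> fin_cases j <;> simp [blockA] <;> module

theorem blockB_add (x y : Grass 4) : blockB (x + y) = blockB x + blockB y := by
  ext1 i j
  fin_cases i <;> fin_cases j <;> simp [blockB] <;> abel

theorem blockB_smul (r : ℂ) (x : Grass 4) : blockB (r • x) = r • blockB x := by
  ext1 i j
  fin_cases i <;> fin_cases j <;> simp [blockB]

theorem blockH_add (x y : Grass 4) : blockH (x + y) = blockH x + blockH y := by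
  ext1 i j
  fin_cases i <;> fin_cases j <;> simp [blockH] <;> abel

theorem blockH_smul (r : ℂ) (x : Grass 4) : blockH (r • x) = r • blockH x := by
  ext1 i j
  fin_cases i <;> fin_cases j <;> simp [blockH]

/-- The primitive of the coefficient of `ω` whose constant term is the central coordinate. On `K(4)`
the coefficient of `ω` has no constant term, so that the primitive exists (`D_potential`). -/
def potential : Grass 4 × ℂ →ₗ[ℂ] HalfLaurent where
  toFun X := antiD (X.1 Finset.univ) + C X.2
  map_add' X Y := by
    simp only [Prod.fst_add, Prod.snd_add, Pi.add_apply, map_add]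
    abel
  map_smul' r X := by
    rw [Prod.smul_fst, Prod.smul_snd, Pi.smul_apply, map_smul, smul_eq_mul, map_mul,
      RingHom.id_apply, smul_add, smul_eq_C_mul r (C X.2)]

theorem potential_apply (X : Grass 4 × ℂ) : potential X = antiD (X.1 Finset.univ) + C X.2 := rfl

theorem coeff_zero_potential (X : Grass 4 × ℂ) : (potential X).coeff 0 = X.2 := by
  rw [potential_apply, AddMonoidAlgebra.coeff_add, Finsupp.add_apply, coeff_antiD, C_apply]
  simp

theorem D_potential {τ : Sector} {X : Grass 4 × ℂ} (hX : X ∈ KHat4 τ) :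
    D (potential X) = X.1 Finset.univ := by
  have h := D_antiD (X.1 Finset.univ)
  rw [(mem_K4_iff.1 hX.1).2, map_zero, add_zero] at h
  rw [potential_apply, map_add, h, D_C, add_zero]

/-- The homomorphism `K̂(4) → CK(6)`, on all of `Grass 4 × ℂ`. -/
def hatToCK : Grass 4 × ℂ →ₗ[ℂ] Mat8 where
  toFun X := toCK X.1 (potential X)
  map_add' X Y := by
    simp only [toCK, map_add, Prod.fst_add, blockA_add, blockB_add, blockH_add, Pi.add_apply,
      ckMatrix_add]
  map_smul' r X := by
    simp only [toCK, map_smul, Prod.smul_fst, blockA_smul, blockB_smul, blockH_smul, Pi.smul_apply,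
      ckMatrix_smul, RingHom.id_apply]

theorem hatToCK_apply (X : Grass 4 × ℂ) : hatToCK X = toCK X.1 (potential X) := rfl

theorem br_mem_KHat4 {τ : Sector} {X Y : Grass 4 × ℂ} (hX : X ∈ KHat4 τ) (hY : Y ∈ KHat4 τ) :
    contactHat.br X Y ∈ KHat4 τ :=
  ⟨Submodule.subset_span ⟨_, (mem_K4_iff.1 hX.1).1, _, (mem_K4_iff.1 hY.1).1, rfl⟩, trivial⟩

/-- The cocycle `ψ` supplies the constant of integration. -/
theorem potential_br (X Y : Grass 4 × ℂ) :
    potential (contactHat.br X Y) = mul (halfEuler X.1) Y.1 Finset.univ := by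
  change antiD (contactBracket form4 X.1 Y.1 Finset.univ) + C (psi X.1 Y.1) = _
  rw [contactBracket_form4_univ, psi, antiD_D]

theorem hatToCK_br {τ : Sector} {X Y : Grass 4 × ℂ} (hX : X ∈ KHat4 τ) (hY : Y ∈ KHat4 τ) :
    hatToCK (contactHat.br X Y) = Mat8.superCommutator (hatToCK X) (hatToCK Y) := by
  rw [hatToCK_apply, hatToCK_apply, hatToCK_apply,
    superCommutator_toCK (D_potential hX) (D_potential hY), potential_br]
  rfl

theorem hatToCK_mem_CK6 {τ : Sector} {X : Grass 4 × ℂ} (hX : X ∈ KHat4 τ) :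
    hatToCK X ∈ CK6 τ := by
  have hx := (mem_K4_iff.1 hX.1).1
  have heven {S : Finset (Fin 4)} (hS : Even S.card) : X.1 S ∈ integralPowers := by
    simpa [Sector.coeff, hS] using hx S
  have hodd {S : Finset (Fin 4)} (hS : ¬ Even S.card) : X.1 S ∈ τ.oddCoeff := by
    simpa [Sector.coeff, hS] using hx S
  have hh : potential X ∈ integralPowers := by
    rw [mem_integralPowers τ]
    exact add_mem (Sector.antiD_mem_coeff ((mem_integralPowers τ).1 (heven (by decide))))
      (τ.C_mem_coeff_zero _)
  have h01 := heven (S := {0, 1}) (by decide)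
  have h23 := heven (S := {2, 3}) (by decide)
  have hp := Submodule.smul_mem _ (1/2 : ℂ) (add_mem h01 h23)
  have hm := Submodule.smul_mem _ (1/2 : ℂ) (sub_mem h01 h23)
  refine ⟨_, heven (by decide), blockA X.1 (potential X), blockB X.1, blockH X.1, ?_, ?_, ?_, ?_,
    ?_, ?_, rfl⟩
  · intro i j
    fin_cases i <;> fin_cases j
    exacts [add_mem hp hh, heven (by decide), zero_mem _, zero_mem _,
      neg_mem (heven (by decide)), add_mem (neg_mem hp) hh, zero_mem _, zero_mem _,
      zero_mem _, zero_mem _, sub_mem hm hh, heven (by decide),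
      zero_mem _, zero_mem _, neg_mem (heven (by decide)), sub_mem (neg_mem hm) hh]
  · simp [Matrix.trace, Fin.sum_univ_four, blockA]
    module
  · intro i j
    fin_cases i <;> fin_cases j <;>
      first
      | exact zero_mem _
      | exact hodd (by decide)
      | exact neg_mem (hodd (by decide))
  · ext1 i j
    fin_cases i <;> fin_cases j <;> simp [blockB]
  · intro i j
    fin_cases i <;> fin_cases j <;>
      first
      | exact zero_mem _
      | exact hodd (by decide)
      | exact neg_mem (hodd (by decide))
  · ext1 i j
    fin_cases i <;> fin_cases j <;> rfl

/-- The blocks are recovered by evaluating the operators at `1` and at `t`. -/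
theorem ckMatrix_eq_zero {f : HalfLaurent} {a b h : Matrix (Fin 4) (Fin 4) HalfLaurent}
    (e : ckMatrix f a b h = 0) : f = 0 ∧ a = 0 ∧ b = 0 ∧ h = 0 := by
  have e11 (i j : Fin 4) (u : HalfLaurent) : ckMatrix f a b h (.inl i) (.inl j) u = 0 := by
    rw [e]; rfl
  have e12 (i j : Fin 4) (u : HalfLaurent) : ckMatrix f a b h (.inl i) (.inr j) u = 0 := by
    rw [e]; rfl
  have e21 (i j : Fin 4) (u : HalfLaurent) : ckMatrix f a b h (.inr i) (.inl j) u = 0 := by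
    rw [e]; rfl
  have hf : f = 0 := by
    have h1 := e11 0 0 1
    have h2 := e11 0 0 (T 2)
    simp [ckMatrix, mulOp_apply, D_T, -LinearMap.map_smul_of_tower] at h1 h2
    have h3 : f * T 2 = 0 := by
      linear_combination (norm := (simp only [smul_eq_C_mul]; ring)) h2 - T 2 * h1
    exact (isUnit_T 2).mul_left_eq_zero.1 h3
  subst hf
  have hb : b = 0 := by
    ext1 i j
    simpa [ckMatrix, mulOp_apply] using e12 i j 1
  subst hb
  refine ⟨rfl, ?_, rfl, ?_⟩
  · ext1 i j
    simpa [ckMatrix, mulOp_apply, diagonal_apply] using e11 i j 1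
  · ext1 i j
    have hphi : phi (0 : Matrix (Fin 4) (Fin 4) HalfLaurent) = 0 := by
      simpa using phi_smul 0 0
    simpa [ckMatrix, mulOp_apply, hphi] using e21 i j 1

theorem hatToCK_injOn {τ : Sector} {X : Grass 4 × ℂ} (hX : X ∈ KHat4 τ) (e : hatToCK X = 0) :
    X = 0 := by
  obtain ⟨h, hA, hB, hH⟩ := ckMatrix_eq_zero e
  have hA (i j : Fin 4) : blockA X.1 (potential X) i j = 0 := by rw [hA]; rfl
  have hB (i j : Fin 4) : blockB X.1 i j = 0 := by rw [hB]; rfl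
  have hH (i j : Fin 4) : blockH X.1 i j = 0 := by rw [hH]; rfl
  have h00 : (1/2 : ℂ) • (X.1 {0, 1} + X.1 {2, 3}) + potential X = 0 := hA 0 0
  have h11 : -((1/2 : ℂ) • (X.1 {0, 1} + X.1 {2, 3})) + potential X = 0 := hA 1 1
  have h22 : (1/2 : ℂ) • (X.1 {0, 1} - X.1 {2, 3}) - potential X = 0 := hA 2 2
  have hp : potential X = 0 := by
    linear_combination (norm := module) (1/2 : ℂ) • (h00 + h11)
  refine Prod.ext (funext fun S => ?_) (by rw [← coeff_zero_potential, hp]; rfl)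
  rcases finset_four_cases S with rfl | rfl | rfl | rfl | rfl | rfl | rfl | rfl | rfl | rfl | rfl |
    rfl | rfl | rfl | rfl | rfl
  · exact h
  · exact hB 0 2
  · exact neg_eq_zero.1 (hB 1 3)
  · exact hB 0 3
  · exact hB 1 2
  · linear_combination (norm := (simp; module)) h00 + h22
  · exact hA 0 1
  · exact hA 2 3
  · exact neg_eq_zero.1 (hA 3 2)
  · exact neg_eq_zero.1 (hA 1 0)
  · linear_combination (norm := (simp; module)) h00 - h22 - (2 : ℂ) • hp
  · exact neg_eq_zero.1 (hH 1 2)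
  · exact hH 0 3
  · exact hH 1 3
  · exact hH 0 2
  · rw [← D_potential hX, hp, map_zero]; rfl

/-! ### The centralizer of `c` -/

/-- The weights of `c` on `V`. -/
def weight : Fin 4 → ℂ := ![1, 1, -1, -1]

theorem ckC_eq_toCK : ckC = toCK 0 1 := by
  rw [ckC, h₁, h₂, h₃, ckCoroot, ckCoroot, ckCoroot, ← ckMatrix_smul, ← ckMatrix_add, ← ckMatrix_add,
    toCK]
  congr 1
  · simp
  · ext1 i j
    fin_cases i <;> fin_cases j <;> simp [blockA] <;> module
  · ext1 i j
    fin_cases i <;> fin_cases j <;> simp [blockB]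
  · ext1 i j
    fin_cases i <;> fin_cases j <;> simp [blockH]

theorem ckC_eq_fromBlocks : ckC = fromBlocks (diagonal fun i => weight i • 1) 0 0
    (-diagonal fun i => weight i • 1) := by
  have hA : blockA 0 1 = diagonal fun i => C (weight i) := by
    ext1 i j
    fin_cases i <;> fin_cases j <;> simp [blockA, weight]
  have hB : blockB 0 = 0 := by
    ext1 i j
    fin_cases i <;> fin_cases j <;> simp [blockB]
  have hH : blockH 0 = 0 := by
    ext1 i j
    fin_cases i <;> fin_cases j <;> simp [blockH]
  have hphi : phi (0 : Matrix (Fin 4) (Fin 4) HalfLaurent) = 0 := by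
    simpa using phi_smul 0 0
  have hC (r : ℂ) : mulOp (C r) = r • 1 := by
    rw [← mul_one (C r), ← smul_eq_C_mul, map_smul]
    congr 1
    exact LinearMap.ext fun u => one_mul u
  rw [ckC_eq_toCK, toCK, ckMatrix, hA, hB, hH, hphi, diagonal_transpose,
    Matrix.diagonal_map (map_zero _)]
  simp [hC, Matrix.map_zero]

/-- The element `c` is the image of the central element of `K̂(4)`. -/
theorem superCommutator_ckC_toCK (x : Grass 4) (h : HalfLaurent) (hx : D h = x Finset.univ) :
    Mat8.superCommutator ckC (toCK x h) = 0 := by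
  have h1 : contactBracket form4 0 x = 0 := by
    ext1 S
    have h0 : (contactVir 0 : Grass 4) = 0 := Pi.single_zero _
    rw [← h0, contactBracket_contactVir, h0]
    simp
  have h2 : mul (halfEuler 0) x Finset.univ = 0 := by
    rw [mul_halfEuler_univ]
    simp
  have h3 : toCK 0 0 = hatToCK 0 := by
    rw [hatToCK_apply, map_zero]
    rfl
  rw [ckC_eq_toCK, superCommutator_toCK (by simp) hx, h1, h2, h3, map_zero]

/-- A matrix of the centralizer of `c` has weight zero. -/
theorem weight_eq_zero {f : HalfLaurent} {a b h : Matrix (Fin 4) (Fin 4) HalfLaurent}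
    (e : Mat8.superCommutator ckC (ckMatrix f a b h) = 0) (i j : Fin 4) :
    (weight i - weight j) • a i j = 0 ∧ (weight i + weight j) • b i j = 0 ∧
      (weight i + weight j) • (h i j + (1/2 : ℂ) • D (phi b i j)) = 0 := by
  rw [ckC_eq_fromBlocks, ckMatrix, Mat8.superCommutator_fromBlocks] at e
  refine ⟨?_, ?_, ?_⟩
  · by_cases hij : i = j
    · simp [hij]
    have h1 := LinearMap.congr_fun (congrFun (congrFun e (.inl i)) (.inl j)) 1
    simpa [sub_smul, mulOp_apply, hij] using h1
  · have h1 := LinearMap.congr_fun (congrFun (congrFun e (.inl i)) (.inr j)) 1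
    simpa [add_smul, mulOp_apply] using h1
  · have h1 := LinearMap.congr_fun (congrFun (congrFun e (.inr i)) (.inl j)) 1
    simp [mulOp_apply] at h1
    linear_combination (norm := module) -h1

/-- The element of `Grass 4` with given blocks; the coefficient of `c` in the block `a` is half the
trace of its upper left `2 × 2` block. -/
def ofBlocks (f : HalfLaurent) (a b h : Matrix (Fin 4) (Fin 4) HalfLaurent) : Grass 4 :=
  Pi.single ∅ f + Pi.single {0} (b 0 2) + Pi.single {1} (-b 1 3) + Pi.single {2} (b 0 3) +
    Pi.single {3} (b 1 2) + Pi.single {0, 1} (a 0 0 + a 2 2) + Pi.single {0, 2} (a 0 1) +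
    Pi.single {0, 3} (a 2 3) + Pi.single {1, 2} (-a 3 2) + Pi.single {1, 3} (-a 1 0) +
    Pi.single {2, 3} (a 0 0 + a 3 3) + Pi.single {0, 1, 2} (-h 1 2) +
    Pi.single {0, 1, 3} (h 0 3) + Pi.single {0, 2, 3} (h 1 3) + Pi.single {1, 2, 3} (h 0 2) +
    Pi.single Finset.univ (D ((1/2 : ℂ) • (a 0 0 + a 1 1)))

theorem ofBlocks_apply (f : HalfLaurent) (a b h : Matrix (Fin 4) (Fin 4) HalfLaurent) :
    ofBlocks f a b h ∅ = f ∧ ofBlocks f a b h {0} = b 0 2 ∧ ofBlocks f a b h {1} = -b 1 3 ∧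
    ofBlocks f a b h {2} = b 0 3 ∧ ofBlocks f a b h {3} = b 1 2 ∧
    ofBlocks f a b h {0, 1} = a 0 0 + a 2 2 ∧ ofBlocks f a b h {0, 2} = a 0 1 ∧
    ofBlocks f a b h {0, 3} = a 2 3 ∧ ofBlocks f a b h {1, 2} = -a 3 2 ∧
    ofBlocks f a b h {1, 3} = -a 1 0 ∧ ofBlocks f a b h {2, 3} = a 0 0 + a 3 3 ∧
    ofBlocks f a b h {0, 1, 2} = -h 1 2 ∧ ofBlocks f a b h {0, 1, 3} = h 0 3 ∧
    ofBlocks f a b h {0, 2, 3} = h 1 3 ∧ ofBlocks f a b h {1, 2, 3} = h 0 2 ∧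
    ofBlocks f a b h Finset.univ = D ((1/2 : ℂ) • (a 0 0 + a 1 1)) := by
  refine ⟨?_, ?_, ?_, ?_, ?_, ?_, ?_, ?_, ?_, ?_, ?_, ?_, ?_, ?_, ?_, ?_⟩ <;>
    simp +decide only [ofBlocks, Pi.add_apply, Pi.single_apply, if_true, if_false, add_zero,
      zero_add]

theorem exists_hatToCK_eq {X : Mat8} (hX : X ∈ centralizerC) :
    ∃ Y ∈ KHat4 .ramond, hatToCK Y = X := by
  obtain ⟨⟨f, hf, a, b, h, ha, hat, hb, hbt, hh, hht, rfl⟩, e⟩ := hX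
  have hw := weight_eq_zero e
  have hr (k : ℕ) : Sector.ramond.coeff k = integralPowers := by
    simp [Sector.coeff, Sector.oddCoeff]
  have hc : (1/2 : ℂ) • (a 0 0 + a 1 1) ∈ integralPowers :=
    Submodule.smul_mem _ _ (add_mem (ha 0 0) (ha 1 1))
  have hmem : ofBlocks f a b h ∈ K4 .ramond := by
    have hu := (ofBlocks_apply f a b h).2.2.2.2.2.2.2.2.2.2.2.2.2.2.2
    refine mem_K4_iff.2 ⟨fun S => ?_, by rw [hu, coeff_zero_D]⟩
    rw [hr]
    rcases finset_four_cases S with rfl | rfl | rfl | rfl | rfl | rfl | rfl | rfl | rfl | rfl |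
      rfl | rfl | rfl | rfl | rfl | rfl <;> simp only [ofBlocks_apply]
    exacts [hf, hb _ _, neg_mem (hb _ _), hb _ _, hb _ _, add_mem (ha _ _) (ha _ _), ha _ _, ha _ _,
      neg_mem (ha _ _), neg_mem (ha _ _), add_mem (ha _ _) (ha _ _), neg_mem (hh _ _), hh _ _,
      hh _ _, hh _ _,
      (mem_integralPowers .ramond).2 (Sector.D_mem_coeff ((mem_integralPowers .ramond).1 hc))]
  -- The constant of integration that makes the potential equal to the coefficient of `c`.
  refine ⟨(ofBlocks f a b h, ((1/2 : ℂ) • (a 0 0 + a 1 1)).coeff 0), ⟨hmem, trivial⟩, ?_⟩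
  have hp : potential (ofBlocks f a b h, ((1/2 : ℂ) • (a 0 0 + a 1 1)).coeff 0) =
      (1/2 : ℂ) • (a 0 0 + a 1 1) := by
    simp only [potential_apply, ofBlocks_apply, antiD_D]
  rw [hatToCK_apply, hp, toCK]
  have hb' (i j : Fin 4) : b j i = -b i j := congrFun (congrFun hbt i) j
  have hh' (i j : Fin 4) : h j i = h i j := congrFun (congrFun hht i) j
  rw [Matrix.trace, Fin.sum_univ_four] at hat
  simp only [Matrix.diag_apply] at hat
  have ha0 (i j : Fin 4) (hij : weight i - weight j ≠ 0) : a i j = 0 :=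
    (smul_eq_zero.1 (hw i j).1).resolve_left hij
  have hb0 (i j : Fin 4) (hij : weight i + weight j ≠ 0) : b i j = 0 :=
    (smul_eq_zero.1 (hw i j).2.1).resolve_left hij
  have hs : (1 : ℂ) + 1 ≠ 0 := by norm_num
  have hs' : -1 + (-1 : ℂ) ≠ 0 := by norm_num
  have hd : (1 : ℂ) - -1 ≠ 0 := by norm_num
  have hd' : (-1 : ℂ) - 1 ≠ 0 := by norm_num
  have b01 := hb0 0 1 hs
  have b23 := hb0 2 3 hs'
  -- `φ` exchanges the vanishing entries `b 0 1` and `b 2 3`, up to sign, so the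
  -- term with `φ(b)` drops out.
  have hphi {i j : Fin 4} (hij : weight i + weight j ≠ 0) : phi b i j = 0 := by
    fin_cases i <;> fin_cases j <;> simp [weight] at hij <;> simp [phi, b01, b23]
  have hh0 (i j : Fin 4) (hij : weight i + weight j ≠ 0) : h i j = 0 := by
    have h1 := (smul_eq_zero.1 (hw i j).2.2).resolve_left hij
    rwa [hphi hij, map_zero, smul_zero, add_zero] at h1
  congr 1
  · exact (ofBlocks_apply f a b h).1
  · ext1 i j
    fin_cases i <;> fin_cases j <;> simp only [blockA, ofBlocks_apply]
    -- The diagonal entries agree because the trace of `a` is zero.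
    exacts [by linear_combination (norm := (simp; module)) (1/2 : ℂ) • hat, rfl,
      (ha0 0 2 hd).symm, (ha0 0 3 hd).symm, neg_neg _,
      by linear_combination (norm := (simp; module)) (-1/2 : ℂ) • hat, (ha0 1 2 hd).symm,
      (ha0 1 3 hd).symm, (ha0 2 0 hd').symm, (ha0 2 1 hd').symm,
      by linear_combination (norm := (simp; module)) (-1/2 : ℂ) • hat, rfl, (ha0 3 0 hd').symm,
      (ha0 3 1 hd').symm, neg_neg _,
      by linear_combination (norm := (simp; module)) (-1/2 : ℂ) • hat]
  · ext1 i j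
    fin_cases i <;> fin_cases j <;> simp only [blockB, ofBlocks_apply]
    exacts [(hb0 0 0 hs).symm, (hb0 0 1 hs).symm, rfl, rfl, (hb0 1 0 hs).symm, (hb0 1 1 hs).symm,
      rfl, neg_neg _, (hb' 0 2).symm, (hb' 1 2).symm, (hb0 2 2 hs').symm, (hb0 2 3 hs').symm,
      (hb' 0 3).symm, (hb' 1 3).symm, (hb0 3 2 hs').symm, (hb0 3 3 hs').symm]
  · ext1 i j
    fin_cases i <;> fin_cases j <;> simp only [blockH, ofBlocks_apply]
    exacts [(hh0 0 0 hs).symm, (hh0 0 1 hs).symm, rfl, rfl, (hh0 1 0 hs).symm, (hh0 1 1 hs).symm,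
      neg_neg _, rfl, (hh' 0 2).symm, (neg_neg _).trans (hh' 1 2).symm, (hh0 2 2 hs').symm,
      (hh0 2 3 hs').symm, (hh' 0 3).symm, (hh' 1 3).symm, (hh0 3 2 hs').symm, (hh0 3 3 hs').symm]

theorem hatToCK_mem_centralizerC {X : Grass 4 × ℂ} (hX : X ∈ KHat4 .ramond) :
    hatToCK X ∈ centralizerC :=
  ⟨hatToCK_mem_CK6 hX, superCommutator_ckC_toCK _ _ (D_potential hX)⟩

theorem hatToCK_restrict_injective {τ : Sector} {S : Submodule ℂ Mat8}
    (h : ∀ X ∈ KHat4 τ, hatToCK X ∈ S) : Function.Injective (hatToCK.restrict h) := by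
  rw [injective_iff_map_eq_zero]
  exact fun X hX => Subtype.ext (hatToCK_injOn X.2 (congrArg Subtype.val hX))

theorem isSuperHom_hatToCK {τ : Sector} {S : Submodule ℂ Mat8}
    (h : ∀ X ∈ KHat4 τ, hatToCK X ∈ S) :
    IsSuperHom contactHat Mat8.superBracket (hatToCK.restrict h) where
  map_even X hX := by
    have h0 {S : Finset (Fin 4)} (hS : Odd S.card) : X.1.1 S = 0 := hX.1 S hS
    have h012 := h0 (S := {0, 1, 2}) (by decide)
    have h013 := h0 (S := {0, 1, 3}) (by decide)
    have h023 := h0 (S := {0, 2, 3}) (by decide)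
    have h123 := h0 (S := {1, 2, 3}) (by decide)
    have hB : blockB X.1.1 = 0 := by
      ext1 i j
      fin_cases i <;> fin_cases j <;> simp +decide [blockB, h0]
    have hH : blockH X.1.1 = 0 := by
      ext1 i j
      fin_cases i <;> fin_cases j <;> simp [blockH, h012, h013, h023, h123]
    have hphi : phi (0 : Matrix (Fin 4) (Fin 4) HalfLaurent) = 0 := by
      simpa using phi_smul 0 0
    change toBlocks₁₂ (toCK X.1.1 _) = 0 ∧ toBlocks₂₁ (toCK X.1.1 _) = 0
    rw [toCK, hB, hH, ckMatrix, hphi]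
    constructor
    · simp [Matrix.map_zero]
    · ext1 i j
      simp
  map_odd X hX := by
    have h0 {S : Finset (Fin 4)} (hS : Even S.card) : X.1.1 S = 0 := hX.1 S hS
    have hz : X.1.2 = 0 := hX.2
    have hp : potential X.1 = 0 := by
      rw [potential_apply, hz, h0 (by decide), map_zero, map_zero, add_zero]
    have hA : blockA X.1.1 (potential X.1) = 0 := by
      rw [hp]
      ext1 i j
      fin_cases i <;> fin_cases j <;> simp +decide [blockA, h0]
    change toBlocks₁₁ (toCK X.1.1 (potential X.1)) = 0 ∧ toBlocks₂₂ (toCK X.1.1 (potential X.1)) = 0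
    rw [toCK, hA, h0 (by decide), ckMatrix]
    constructor <;>
    · ext1 i j
      simp
  map_br X Y := ⟨br_mem_KHat4 X.2 Y.2, hatToCK_br X.2 Y.2⟩

theorem preservesVir_hatToCK {τ : Sector} {S : Submodule ℂ Mat8}
    (h : ∀ X ∈ KHat4 τ, hatToCK X ∈ S) :
    PreservesVir contactHatVir ckVir (hatToCK.restrict h) := by
  intro f hf
  have h0 {S : Finset (Fin 4)} (hS : S ≠ ∅) : (contactVir f : Grass 4) S = 0 := by
    rw [contactVir, Pi.single_eq_of_ne hS]
  have hu : (contactVir f : Grass 4) Finset.univ = 0 := h0 (by decide)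
  have hp : potential (contactHatVir f) = 0 := by
    change antiD ((contactVir f : Grass 4) Finset.univ) + C 0 = 0
    rw [hu, map_zero, map_zero, add_zero]
  refine ⟨⟨mem_K4_iff.2 ⟨contactVir_mem_KD τ hf, congrArg (fun g => g.coeff 0) hu⟩, trivial⟩, ?_⟩
  have hf0 : (contactVir f : Grass 4) ∅ = f := by
    rw [contactVir, Pi.single_eq_same]
  have hA : blockA (contactVir f) 0 = 0 := by
    ext1 i j
    fin_cases i <;> fin_cases j <;> simp [blockA, h0]
  have hB : blockB (contactVir f) = 0 := by
    ext1 i j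
    fin_cases i <;> fin_cases j <;> simp [blockB, h0]
  have hH : blockH (contactVir f) = 0 := by
    ext1 i j
    fin_cases i <;> fin_cases j <;> simp [blockH, h0]
  change toCK (contactVir f) (potential (contactHatVir f)) = ckVir f
  rw [hp, toCK, hA, hB, hH, hf0, ckVir]

end Superconformal

end

theorem mainTheorem8 :
    (∃ φ : KHat4 .ramond ≃ₗ[ℂ] centralizerC,
      IsSuperHom contactHat Mat8.superBracket φ.toLinearMap ∧
      PreservesVir contactHatVir ckVir φ.toLinearMap) ∧
    ∀ τ : Sector,
      (∃ ι : K3 τ →ₗ[ℂ] KHat4 τ, Function.Injective ι ∧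
        IsSuperHom (contact form3) contactHat ι ∧
        PreservesVir contactVir contactHatVir ι) ∧
      (∃ κ : KHat4 τ →ₗ[ℂ] CK6 τ, Function.Injective κ ∧
        IsSuperHom contactHat Mat8.superBracket κ ∧
        PreservesVir contactHatVir ckVir κ) := by
  refine ⟨?_, fun τ => ⟨⟨substHat τ, substHat_injective τ, isSuperHom_substHat τ,
    preservesVir_substHat τ⟩, hatToCK.restrict fun _ => hatToCK_mem_CK6,
    hatToCK_restrict_injective _, isSuperHom_hatToCK _, preservesVir_hatToCK _⟩⟩
  have h : ∀ X ∈ KHat4 .ramond, hatToCK X ∈ centralizerC := fun _ => hatToCK_mem_centralizerC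
  have hsurj : Function.Surjective (hatToCK.restrict h) := fun X => by
    obtain ⟨Y, hY, e⟩ := exists_hatToCK_eq X.2
    exact ⟨⟨Y, hY⟩, Subtype.ext e⟩
  exact ⟨LinearEquiv.ofBijective _ ⟨hatToCK_restrict_injective h, hsurj⟩, isSuperHom_hatToCK h,
    preservesVir_hatToCK h⟩
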